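/- All vector lattices are real and Archimedean. A net $(x_\alpha)$ in a vector lattice $E$ converges uniformly to $x\in E$ if there is $e\in E_+$ such that for every $\varepsilon>0$ one has $|x_\alpha-x|\le\varepsilon e$ for all sufficiently large $\alpha$; a set is uniformly closed in $E$ if it contains the limits of all nets in it that converge uniformly in $E$; $E$ is uniformly complete if every net $(x_\alpha)$ for which $(x_\alpha-x_\beta)_{(\alpha,\beta)}$ converges uniformly to $0$ converges uniformly in $E$. An order completion of $E$ is an order complete vector lattice $E^\delta$ with an embedding of $E$ as an order dense majorizing sublattice, and the uniform completion $E^{\rm ru}$ is the intersection of all uniformly complete sublattices of $E^\delta$ that contain $E$. A linear operator is order bounded if it maps order intervals to order bounded sets. Let $P=[0,1]\setminus\mathbb Q$ and let $C(P)$ be the vector lattice of continuous real functions on $P$, with $C[0,1]$ viewed as a subspace of it by restriction. The subspace $$X=C[0,1]+\operatorname{span}\Bigl\{\tfrac1{|t-q|}\ :\ q\in[0,1]\cap\mathbb Q\Bigr\}$$ is a sublattice of $C(P)$. Let $(r_n)_{n\ge1}$ be an enumeration without repetitions of $[0,1]\cap\mathbb Q$, let $$g(t)=\sum_{n=1}^\infty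 2^{-n}\sin\frac1{|t-r_n|}\qquad(t\in P),$$ which is an element of $C(P)$, and let $Y$ be the sublattice of $C(P)$ generated by $X$ and $g$. Then: 1. $X$ is uniformly closed in $Y$, and $X\ne Y$. 2. $Y$ has an order completion $Y^\delta$; every order completion $Y^\delta$ of $Y$ is also an order completion of $X$, and in it $Y^{\rm ru}=X^{\rm ru}$. 3. For every vector lattice $H$, every order bounded operator $T\colon Y\to H$ that vanishes on $X$ is zero. Consequently, $X$ is a uniformly closed sublattice of $Y$ that is not the kernel of any order bounded operator from $Y$ to a vector lattice. -/

import Mathlib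

open Set Filter Topology

universe u v

/-! ### Vector lattices and relative uniform convergence

A real vector lattice is a type with the instances `AddCommGroup`, `Lattice`, `IsOrderedAddMonoid`,
`Module ℝ` and `IsOrderedModule ℝ`. -/

section VectorLattices

/-- A vector lattice is Archimedean if `x ≤ 0` whenever all multiples `n x` lie below one vector. -/
def IsArchimedeanVL (E : Type*) [AddCommGroup E] [Lattice E] : Prop :=
  ∀ x y : E, (∀ n : ℕ, n • x ≤ y) → x ≤ 0

/-- The net `x` converges to `a` uniformly in `E`, relative to some regulator `e` in `E`. -/
def UniformlyConvergesTo {E : Type*} [AddCommGroup E] [Lattice E] [Module ℝ E]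
    {ι : Type*} [Preorder ι] (x : ι → E) (a : E) : Prop :=
  ∃ e : E, 0 ≤ e ∧ ∀ ε : ℝ, 0 < ε → ∃ i₀ : ι, ∀ i : ι, i₀ ≤ i → |x i - a| ≤ ε • e

/-- A net is uniformly Cauchy if the net of differences, indexed by the product, converges
uniformly to zero. -/
def UniformlyCauchy {E : Type*} [AddCommGroup E] [Lattice E] [Module ℝ E]
    {ι : Type*} [Preorder ι] (x : ι → E) : Prop :=
  UniformlyConvergesTo (fun p : ι × ι => x p.1 - x p.2) 0

/-- A subset is uniformly closed if it contains the limits of all uniformly convergent nets in it.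
(Sequences are among these nets, and are enough.) -/
def IsUniformlyClosed {E : Type*} [AddCommGroup E] [Lattice E] [Module ℝ E] (A : Set E) : Prop :=
  ∀ (ι : Type) [Preorder ι] [IsDirectedOrder ι] [Nonempty ι] (x : ι → E) (a : E),
    (∀ i, x i ∈ A) → UniformlyConvergesTo x a → a ∈ A

/-- A vector lattice is uniformly complete if every uniformly Cauchy net converges uniformly. -/
def IsUniformlyComplete (E : Type*) [AddCommGroup E] [Lattice E] [Module ℝ E] : Prop :=
  ∀ (ι : Type) [Preorder ι] [IsDirectedOrder ι] [Nonempty ι] (x : ι → E),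
    UniformlyCauchy x → ∃ a : E, UniformlyConvergesTo x a

/-- A linear operator is order bounded if it maps order intervals into order intervals. -/
def IsOrderBoundedOp {E F : Type*} [AddCommGroup E] [Lattice E] [Module ℝ E]
    [AddCommGroup F] [Lattice F] [Module ℝ F] (T : E →ₗ[ℝ] F) : Prop :=
  ∀ a b : E, ∃ c d : F, ∀ x : E, a ≤ x → x ≤ b → c ≤ T x ∧ T x ≤ d

end VectorLattices

/-! ### Vector sublattices -/

/-- A (vector) sublattice: a linear subspace closed under the lattice operations.
Closure under `⊓` follows, see `VectorSublattice.inf_mem`. -/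
structure VectorSublattice (E : Type*) [AddCommGroup E] [Lattice E] [Module ℝ E]
    extends Submodule ℝ E where
  sup_mem' : ∀ {a b : E}, a ∈ carrier → b ∈ carrier → a ⊔ b ∈ carrier

namespace VectorSublattice

variable {E : Type*} [AddCommGroup E] [Lattice E] [Module ℝ E]

instance instSetLike : SetLike (VectorSublattice E) E where
  coe S := S.carrier
  coe_injective := by
    rintro ⟨⟨⟨⟨a, _⟩, _⟩, _⟩, _⟩ ⟨⟨⟨⟨b, _⟩, _⟩, _⟩, _⟩ h
    have h' : a = b := h
    subst h'
    rfl

instance instPartialOrder : PartialOrder (VectorSublattice E) := .ofSetLike (VectorSublattice E) E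

instance instAddSubgroupClass : AddSubgroupClass (VectorSublattice E) E where
  add_mem {S} _ _ ha hb := S.toSubmodule.add_mem ha hb
  zero_mem S := S.toSubmodule.zero_mem
  neg_mem {S} _ ha := S.toSubmodule.neg_mem ha

instance instSMulMemClass : SMulMemClass (VectorSublattice E) ℝ E where
  smul_mem {S} c _ ha := S.toSubmodule.smul_mem c ha

theorem sup_mem (S : VectorSublattice E) {a b : E} (ha : a ∈ S) (hb : b ∈ S) : a ⊔ b ∈ S :=
  S.sup_mem' ha hb

theorem inf_mem [IsOrderedAddMonoid E] (S : VectorSublattice E) {a b : E}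
    (ha : a ∈ S) (hb : b ∈ S) : a ⊓ b ∈ S := by
  have h : a ⊓ b = -(-a ⊔ -b) := by rw [neg_sup, neg_neg, neg_neg]
  rw [h]
  exact neg_mem (S.sup_mem (neg_mem ha) (neg_mem hb))

/-- The order and the lattice operations of a sublattice are those of the ambient space. -/
instance instLattice [IsOrderedAddMonoid E] (S : VectorSublattice E) : Lattice S :=
  Subtype.lattice (fun _ _ ha hb => S.sup_mem ha hb) (fun _ _ ha hb => S.inf_mem ha hb)

instance instIsOrderedAddMonoid [IsOrderedAddMonoid E] (S : VectorSublattice E) :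
    IsOrderedAddMonoid S where
  add_le_add_left a b h c := by
    have h' : (a : E) ≤ b := h
    show (a : E) + c ≤ b + c
    exact add_le_add_left h' (c : E)

instance instIsOrderedModule [IsOrderedAddMonoid E] [IsOrderedModule ℝ E]
    (S : VectorSublattice E) : IsOrderedModule ℝ S where
  smul_le_smul_of_nonneg_left r hr a b h := by
    have h' : (a : E) ≤ b := h
    show r • (a : E) ≤ r • (b : E)
    exact smul_le_smul_of_nonneg_left h' hr
  smul_le_smul_of_nonneg_right a ha r s h := by
    have ha' : (0 : E) ≤ a := ha
    show r • (a : E) ≤ s • (a : E)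
    exact smul_le_smul_of_nonneg_right h ha'

/-- The sublattice generated by a set: the intersection of all sublattices that contain it. -/
def generate (A : Set E) : VectorSublattice E where
  carrier := {x | ∀ S : VectorSublattice E, A ⊆ S → x ∈ S}
  add_mem' ha hb S hS := add_mem (ha S hS) (hb S hS)
  zero_mem' S _ := zero_mem S
  smul_mem' c _ hx S hS := SMulMemClass.smul_mem c (hx S hS)
  sup_mem' ha hb S hS := S.sup_mem (ha S hS) (hb S hS)

theorem subset_generate (A : Set E) : A ⊆ generate A := fun _ hx _ hS => hS hx

/-- The inclusion of a sublattice in a larger one. -/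
def inclusion {S T : VectorSublattice E} (h : S ≤ T) : S →ₗ[ℝ] T where
  toFun x := ⟨(x : E), h x.2⟩
  map_add' _ _ := rfl
  map_smul' _ _ := rfl

end VectorSublattice

/-! ### Order completion and uniform completion -/

/-- `j : E → Z` is an order (Dedekind) completion of `E`: `Z` is order complete and `j` is an
embedding of vector lattices whose range is order dense and majorizing. -/
structure IsOrderCompletion {E Z : Type*} [AddCommGroup E] [Lattice E] [Module ℝ E]
    [AddCommGroup Z] [Lattice Z] [Module ℝ Z] (j : E →ₗ[ℝ] Z) : Prop where
  injective : Function.Injective j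
  map_sup : ∀ a b : E, j (a ⊔ b) = j a ⊔ j b
  order_complete : ∀ A : Set Z, A.Nonempty → BddAbove A → ∃ s : Z, IsLUB A s
  order_dense : ∀ z : Z, 0 < z → ∃ x : E, 0 < j x ∧ j x ≤ z
  majorizing : ∀ z : Z, ∃ x : E, z ≤ j x

/-- The intersection of all uniformly complete sublattices of `Z` that contain the range of `j`.
If `j` is an order completion of `E`, this is the uniform completion of `E`. -/
def uniformCompletionIn {E Z : Type*} [AddCommGroup E] [Module ℝ E]
    [AddCommGroup Z] [Lattice Z] [IsOrderedAddMonoid Z] [Module ℝ Z] (j : E →ₗ[ℝ] Z) : Set Z :=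
  {z | ∀ S : VectorSublattice Z, IsUniformlyComplete S → range j ⊆ S → z ∈ S}

/-! ### The Ball–Hager lattice -/

namespace BallHager

/-- The space `P` of irrational numbers in `[0, 1]`. -/
abbrev P : Type := {t : Icc (0 : ℝ) 1 // Irrational (t : ℝ)}

/-- The underlying real number of a point of `P`. -/
abbrev P.toReal (t : P) : ℝ := ((t : Icc (0 : ℝ) 1) : ℝ)

theorem abs_sub_ne_zero (q : Icc (0 : ℚ) 1) (t : P) : |t.toReal - ((q : ℚ) : ℝ)| ≠ 0 :=
  abs_ne_zero.mpr (sub_ne_zero.mpr (t.2.ne_rat q))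

/-- The function `t ↦ 1 / |t - q|` on `P`. -/
noncomputable def pole (q : Icc (0 : ℚ) 1) : C(P, ℝ) where
  toFun t := 1 / |t.toReal - ((q : ℚ) : ℝ)|
  continuous_toFun := by
    refine continuous_const.div ?_ (abs_sub_ne_zero q)
    exact ((continuous_subtype_val.comp continuous_subtype_val).sub continuous_const).abs

/-- Restriction of functions from `[0, 1]` to `P`. -/
noncomputable def restrict : C(Icc (0 : ℝ) 1, ℝ) →ₗ[ℝ] C(P, ℝ) where
  toFun v := v.comp ⟨Subtype.val, continuous_subtype_val⟩
  map_add' _ _ := rfl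
  map_smul' _ _ := rfl

/-- The linear space `C[0, 1] + span {1 / |t - q|}` of functions on `P`. -/
noncomputable def space : Submodule ℝ C(P, ℝ) :=
  LinearMap.range restrict ⊔ Submodule.span ℝ (range pole)

/-- The point of the real interval `[0, 1]` given by a rational number in `[0, 1]`. -/
def ratPoint (q : Icc (0 : ℚ) 1) : Icc (0 : ℝ) 1 :=
  ⟨((q : ℚ) : ℝ), by exact_mod_cast q.2.1, by exact_mod_cast q.2.2⟩

/-- `f` has a finite limit at the point `x` of `[0, 1]`. -/
def HasLimitAt (f : C(P, ℝ)) (x : Icc (0 : ℝ) 1) : Prop :=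
  ∃ l : ℝ, Tendsto f (comap Subtype.val (𝓝 x)) (𝓝 l)

theorem HasLimitAt.add {f g : C(P, ℝ)} {x : Icc (0 : ℝ) 1} :
    HasLimitAt f x → HasLimitAt g x → HasLimitAt (f + g) x := by
  rintro ⟨a, ha⟩ ⟨b, hb⟩
  exact ⟨a + b, ha.add hb⟩

theorem HasLimitAt.smul {f : C(P, ℝ)} {x : Icc (0 : ℝ) 1} (c : ℝ) :
    HasLimitAt f x → HasLimitAt (c • f) x := by
  rintro ⟨a, ha⟩
  exact ⟨c * a, ha.const_mul c⟩

theorem hasLimitAt_zero (x : Icc (0 : ℝ) 1) : HasLimitAt 0 x := ⟨0, tendsto_const_nhds⟩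

theorem HasLimitAt.sum {ι : Type*} {s : Finset ι} {f : ι → C(P, ℝ)} {x : Icc (0 : ℝ) 1}
    (h : ∀ i ∈ s, HasLimitAt (f i) x) : HasLimitAt (∑ i ∈ s, f i) x :=
  Finset.sum_induction f (fun g => HasLimitAt g x) (fun _ _ => HasLimitAt.add)
    (hasLimitAt_zero x) h

theorem hasLimitAt_of_irrational (f : C(P, ℝ)) {x : Icc (0 : ℝ) 1} (hx : Irrational (x : ℝ)) :
    HasLimitAt f x := by
  refine ⟨f ⟨x, hx⟩, ?_⟩
  have h := f.continuous.tendsto ⟨x, hx⟩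
  rwa [nhds_subtype_eq_comap] at h

theorem hasLimitAt_restrict (v : C(Icc (0 : ℝ) 1, ℝ)) (x : Icc (0 : ℝ) 1) :
    HasLimitAt (restrict v) x :=
  ⟨v x, (v.continuous.tendsto x).comp tendsto_comap⟩

theorem hasLimitAt_pole {q : Icc (0 : ℚ) 1} {x : Icc (0 : ℝ) 1} (h : (x : ℝ) ≠ ((q : ℚ) : ℝ)) :
    HasLimitAt (pole q) x := by
  refine ⟨1 / |(x : ℝ) - ((q : ℚ) : ℝ)|, ?_⟩
  have hc : Tendsto (fun t : P => t.toReal) (comap Subtype.val (𝓝 x)) (𝓝 (x : ℝ)) :=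
    (continuous_subtype_val.tendsto x).comp tendsto_comap
  exact tendsto_const_nhds.div (hc.sub tendsto_const_nhds).abs
    (abs_ne_zero.mpr (sub_ne_zero.mpr h))

theorem tendsto_pole (q : Icc (0 : ℚ) 1) :
    Tendsto (pole q) (comap Subtype.val (𝓝 (ratPoint q))) atTop := by
  have hc : Tendsto (fun t : P => t.toReal) (comap Subtype.val (𝓝 (ratPoint q)))
      (𝓝 ((q : ℚ) : ℝ)) :=
    (continuous_subtype_val.tendsto (ratPoint q)).comp tendsto_comap
  have h0 : Tendsto (fun t : P => |t.toReal - ((q : ℚ) : ℝ)|)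
      (comap Subtype.val (𝓝 (ratPoint q))) (𝓝[>] 0) := by
    refine tendsto_nhdsWithin_iff.mpr ⟨?_, Eventually.of_forall fun t => ?_⟩
    · simpa using (hc.sub_const ((q : ℚ) : ℝ)).abs
    · exact lt_of_le_of_ne (abs_nonneg _) (abs_sub_ne_zero q t).symm
  refine (tendsto_inv_nhdsGT_zero.comp h0).congr fun t => ?_
  simp [pole]

theorem isDenseInducing_val : IsDenseInducing (Subtype.val : P → Icc (0 : ℝ) 1) := by
  refine ⟨⟨rfl⟩, fun x => ?_⟩
  rw [Metric.mem_closure_iff]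
  intro ε hε
  have hx0 := x.2.1
  have hx1 := x.2.2
  obtain ⟨y, hy, h1, h2⟩ := exists_irrational_btwn
    (show max 0 ((x : ℝ) - ε) < min 1 ((x : ℝ) + ε) by
      rw [max_lt_iff, lt_min_iff, lt_min_iff]
      refine ⟨⟨?_, ?_⟩, ?_, ?_⟩ <;> linarith)
  rw [max_lt_iff] at h1
  rw [lt_min_iff] at h2
  refine ⟨⟨y, h1.1.le, h2.1.le⟩, ⟨⟨⟨y, h1.1.le, h2.1.le⟩, hy⟩, rfl⟩, ?_⟩
  rw [Subtype.dist_eq, Real.dist_eq, abs_lt]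
  constructor <;> linarith [h1.2, h2.2]

theorem mem_range_restrict {f : C(P, ℝ)} (h : ∀ x, HasLimitAt f x) :
    f ∈ LinearMap.range restrict := by
  refine ⟨⟨isDenseInducing_val.extend f, isDenseInducing_val.continuous_extend h⟩, ?_⟩
  ext t
  exact isDenseInducing_val.extend_eq f.continuous t

/-- A function belongs to the space iff, up to finitely many poles, it has limits everywhere. -/
theorem mem_space_iff {f : C(P, ℝ)} : f ∈ space ↔
    ∃ α : Icc (0 : ℚ) 1 →₀ ℝ, ∀ q, HasLimitAt (f - α q • pole q) (ratPoint q) := by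
  classical
  constructor
  · intro hf
    obtain ⟨_, ⟨v, rfl⟩, h, hh, rfl⟩ := Submodule.mem_sup.mp hf
    have key : ∃ α : Icc (0 : ℚ) 1 →₀ ℝ, ∀ q, HasLimitAt (h - α q • pole q) (ratPoint q) := by
      refine Submodule.span_induction (p := fun h _ => ∃ α : Icc (0 : ℚ) 1 →₀ ℝ,
        ∀ q, HasLimitAt (h - α q • pole q) (ratPoint q)) ?_ ?_ ?_ ?_ hh
      · rintro _ ⟨r, rfl⟩
        refine ⟨Finsupp.single r 1, fun q => ?_⟩
        by_cases hqr : r = q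
        · subst hqr
          simpa using hasLimitAt_zero (ratPoint r)
        · rw [Finsupp.single_eq_of_ne' hqr, zero_smul, sub_zero]
          refine hasLimitAt_pole fun hx => hqr (Subtype.ext ?_)
          have hx' : ((q : ℚ) : ℝ) = ((r : ℚ) : ℝ) := hx
          exact_mod_cast hx'.symm
      · exact ⟨0, fun q => by simpa using hasLimitAt_zero (ratPoint q)⟩
      · rintro a b _ _ ⟨α, hα⟩ ⟨β, hβ⟩
        refine ⟨α + β, fun q => ?_⟩
        have e : a + b - (α + β) q • pole q = (a - α q • pole q) + (b - β q • pole q) := by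
          rw [Finsupp.add_apply, add_smul]
          abel
        rw [e]
        exact (hα q).add (hβ q)
      · rintro c a _ ⟨α, hα⟩
        refine ⟨c • α, fun q => ?_⟩
        have e : c • a - (c • α) q • pole q = c • (a - α q • pole q) := by
          rw [Finsupp.smul_apply, smul_sub, smul_eq_mul, mul_smul]
        rw [e]
        exact (hα q).smul c
    obtain ⟨α, hα⟩ := key
    refine ⟨α, fun q => ?_⟩
    rw [add_sub_assoc]
    exact (hasLimitAt_restrict v _).add (hα q)
  · rintro ⟨α, hα⟩
    have hsum : ∑ r ∈ α.support, α r • pole r ∈ Submodule.span ℝ (range pole) :=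
      Submodule.sum_mem _ fun r _ => Submodule.smul_mem _ _ (Submodule.subset_span ⟨r, rfl⟩)
    have hv : f - ∑ r ∈ α.support, α r • pole r ∈ LinearMap.range restrict := by
      refine mem_range_restrict fun x => ?_
      by_cases hx : Irrational (x : ℝ)
      · exact hasLimitAt_of_irrational _ hx
      · obtain ⟨q, hq⟩ : ∃ q : ℚ, (q : ℝ) = x := by
          simpa [Irrational] using hx
        have hq01 : q ∈ Icc (0 : ℚ) 1 :=
          ⟨by exact_mod_cast hq ▸ x.2.1, by exact_mod_cast hq ▸ x.2.2⟩
        obtain rfl : ratPoint ⟨q, hq01⟩ = x := Subtype.ext hq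
        have e : f - ∑ r ∈ α.support, α r • pole r = (f - α ⟨q, hq01⟩ • pole ⟨q, hq01⟩) +
            (-1 : ℝ) • ∑ r ∈ α.support.erase ⟨q, hq01⟩, α r • pole r := by
          by_cases hs : (⟨q, hq01⟩ : Icc (0 : ℚ) 1) ∈ α.support
          · rw [← Finset.add_sum_erase _ _ hs, neg_one_smul]
            abel
          · rw [Finset.erase_eq_of_notMem hs, Finsupp.notMem_support_iff.mp hs, zero_smul,
              sub_zero, neg_one_smul, sub_eq_add_neg]
        rw [e]
        refine (hα _).add (HasLimitAt.smul _ (HasLimitAt.sum fun r hr => HasLimitAt.smul _ ?_))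
        refine hasLimitAt_pole fun hx => (Finset.ne_of_mem_erase hr) (Subtype.ext ?_)
        have hx' : (q : ℝ) = ((r : ℚ) : ℝ) := hx
        exact_mod_cast hx'.symm
    have := Submodule.add_mem_sup hv hsum
    rwa [sub_add_cancel] at this

theorem abs_mem_space {f : C(P, ℝ)} (hf : f ∈ space) : |f| ∈ space := by
  obtain ⟨α, hα⟩ := mem_space_iff.mp hf
  refine mem_space_iff.mpr ⟨α.mapRange (fun c => |c|) abs_zero, fun q => ?_⟩
  obtain ⟨l, hl⟩ := hα q
  rw [Finsupp.mapRange_apply]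
  have hfl : Tendsto (fun t => f t - α q * pole q t)
      (comap Subtype.val (𝓝 (ratPoint q))) (𝓝 l) := hl
  have hp := tendsto_pole q
  have habs : ∀ t, (|f| - |α q| • pole q) t = |f t| - |α q| * pole q t := by
    intro t
    simp [ContinuousMap.abs_apply]
  rcases lt_trichotomy (α q) 0 with h | h | h
  · have hb := hfl.add_atBot (hp.const_mul_atTop_of_neg h)
    refine ⟨-l, hfl.neg.congr' ?_⟩
    filter_upwards [hb.eventually_le_atBot 0] with t ht
    rw [sub_add_cancel] at ht
    rw [habs, abs_of_nonpos ht, abs_of_neg h]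
    ring
  · refine ⟨|l|, hfl.abs.congr fun t => ?_⟩
    rw [habs, h]
    simp
  · have hb := hfl.add_atTop (hp.const_mul_atTop h)
    refine ⟨l, hfl.congr' ?_⟩
    filter_upwards [hb.eventually_ge_atTop 0] with t ht
    rw [sub_add_cancel] at ht
    rw [habs, abs_of_nonneg ht, abs_of_pos h]

/-- The Ball–Hager lattice `X`: the above space, which is closed under the lattice operations. -/
noncomputable def lattice : VectorSublattice C(P, ℝ) where
  toSubmodule := space
  sup_mem' {a b} ha hb := by
    have h : a ⊔ b = (2⁻¹ : ℝ) • (a + b + |b - a|) := by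
      ext t
      simp only [ContinuousMap.sup_apply, ContinuousMap.smul_apply, ContinuousMap.add_apply,
        ContinuousMap.abs_apply, ContinuousMap.sub_apply]
      exact sup_eq_half_smul_add_add_abs_sub ℝ (a t) (b t)
    rw [h]
    exact space.smul_mem _
      (space.add_mem (space.add_mem ha hb) (abs_mem_space (space.sub_mem hb ha)))

/-- The function `g(t) = ∑ 2⁻ⁿ sin (1 / |t - rₙ|)` on `P`, summed over `n ≥ 1`, for a sequence
`r 0, r 1, …` of rational numbers in `[0, 1]`; its index is shifted by one. -/
noncomputable def oscillation (r : ℕ → Icc (0 : ℚ) 1) : C(P, ℝ) where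
  toFun t := ∑' n : ℕ, 1 / 2 ^ (n + 1) * Real.sin (1 / |t.toReal - ((r n : ℚ) : ℝ)|)
  continuous_toFun := by
    refine continuous_tsum (u := fun n : ℕ => 1 / 2 * (1 / 2 : ℝ) ^ n) (fun n => ?_)
      (summable_geometric_two.mul_left _) (fun n t => ?_)
    · exact continuous_const.mul (Real.continuous_sin.comp (pole (r n)).continuous)
    · rw [Real.norm_eq_abs, abs_mul, abs_of_pos (by positivity)]
      have h := Real.abs_sin_le_one (1 / |t.toReal - ((r n : ℚ) : ℝ)|)
      calc _ ≤ 1 / 2 ^ (n + 1) * (1 : ℝ) := by gcongr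
        _ = 1 / 2 * (1 / 2 : ℝ) ^ n := by rw [one_div_pow, pow_succ]; field_simp

/-- The sublattice `Y` of `C(P)` generated by `X` and `g`. -/
noncomputable def extension (r : ℕ → Icc (0 : ℚ) 1) : VectorSublattice C(P, ℝ) :=
  VectorSublattice.generate (insert (oscillation r) (lattice : Set C(P, ℝ)))

theorem lattice_le_extension (r : ℕ → Icc (0 : ℚ) 1) : lattice ≤ extension r :=
  fun _ hx => VectorSublattice.subset_generate _ (mem_insert_of_mem _ hx)

end BallHager

/-! ### The Dedekind completion of an Archimedean vector lattice -/

/-! Near a rational point `q`, write `p` for the pole `1/|t - q|`. Every `f` in `Y` has the form `a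
p + φ(sin p) + o(1)` with `φ` continuous, and `a ≠ 0` for only finitely many `q`. Such functions
form a sublattice: if `a ≠ 0`, the pole fixes the sign of `f` near `q`; if `a = 0`, `|f|` has
profile `|φ|`. Since `sin p` clusters at every point of `[-1,1]`, `a` and `φ` on `[-1,1]` are
determined by `f`. The elements of `X` are those whose `φ` is constant there at every `q`, whereas
`g` has a nonconstant affine `φ` at every `q`; so `g ∉ X`.

`X` is uniformly closed in `Y`: let `y` be a limit of elements of `X` with regulator `e` in `Y`.
Where `e` has no pole it is bounded, so the profile of `y` is a uniform limit of constants; hence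
`y` oscillates at most at the finitely many poles of `e`. Moreover `y` agrees pointwise with
finitely many functions `x + c g`, `x ∈ X`. A piece with `c ≠ 0` cannot hold on a nonempty open set,
where `y` would oscillate at infinitely many rationals, so the pieces with `c = 0` already suffice
(`exists_finite_lattice_cover`). Then `φ` takes finitely many values on `[-1,1]`, and connectedness
makes it constant at the remaining points too (`HasProfileAt.eq_const_of_finite_cover`).

Yet `g` is a limit of limits of elements of `X` (`exists_approximation`): its partial sums converge
to it with regulator `1`, and the `N`-th one is a limit of functions in `C[0,1]` with a sum of `N`
poles as regulator. The regulator varies with `N`, which is why one limit is not enough. Uniformly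
complete sublattices and order bounded operators see both limits, which gives the equality of the
uniform completions and the vanishing of the operators.

Order completions of `Y` exist by Dedekind cuts. They also complete `X`, because `X` contains tent
functions below every positive function and majorizes `Y`, `g` being bounded. -/

open scoped NNReal in
/-- A module over the nonnegative reals that is a group is a real vector space. -/
@[reducible] noncomputable def Module.ofNNReal (E : Type*) [AddCommGroup E] [Module ℝ≥0 E] :
    Module ℝ E := by
  let f : ℝ → E → E := fun r z => r.toNNReal • z - (-r).toNNReal • z
  -- The action is `r⁺ z - r⁻ z`; it may be computed from any representation of `r` as a difference,
  -- and this yields the module axioms.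
  have hf : ∀ (a b : ℝ≥0) (r : ℝ) (z : E), r = a - b → f r z = a • z - b • z := by
    intro a b r z h
    have h1 : r.toNNReal + b = a + (-r).toNNReal := by
      apply NNReal.eq
      have := max_zero_sub_eq_self r
      push_cast
      rw [Real.coe_toNNReal', Real.coe_toNNReal', max_comm r, max_comm (-r)]
      have h2 := max_zero_sub_max_neg_zero_eq_self r
      rw [max_comm r, max_comm (-r)] at h2
      linarith
    have h2 : r.toNNReal • z + b • z = a • z + (-r).toNNReal • z := by
      rw [← add_smul, h1, add_smul]
    show r.toNNReal • z - (-r).toNNReal • z = a • z - b • z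
    rw [sub_eq_sub_iff_add_eq_add, h2]
  have hr : ∀ r : ℝ, r = (r.toNNReal : ℝ) - ((-r).toNNReal : ℝ) := by
    intro r
    rw [Real.coe_toNNReal', Real.coe_toNNReal', max_zero_sub_max_neg_zero_eq_self]
  exact
  { smul := f
    one_smul := fun z => (hf 1 0 1 z (by simp)).trans (by simp)
    mul_smul := fun r s z => by
      show f (r * s) z = f r (f s z)
      rw [hf _ _ r _ (hr r), hf _ _ s _ (hr s),
        hf (r.toNNReal * s.toNNReal + (-r).toNNReal * (-s).toNNReal)
          (r.toNNReal * (-s).toNNReal + (-r).toNNReal * s.toNNReal) (r * s) z]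
      · simp only [add_smul, mul_smul, smul_sub]
        abel
      · conv_lhs => rw [hr r, hr s]
        push_cast
        ring
    smul_zero := fun r => by
      show f r 0 = 0
      simp [f]
    smul_add := fun r x y => by
      show f r (x + y) = f r x + f r y
      simp only [f, smul_add]
      abel
    add_smul := fun r s z => by
      show f (r + s) z = f r z + f s z
      rw [hf _ _ r _ (hr r), hf _ _ s _ (hr s),
        hf (r.toNNReal + s.toNNReal) ((-r).toNNReal + (-s).toNNReal) (r + s) z]
      · simp only [add_smul]
        abel
      · conv_lhs => rw [hr r, hr s]
        push_cast
        ring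
    zero_smul := fun z => (hf 0 0 0 z (by simp)).trans (by simp) }

/-- The cuts of a lattice: nonempty sets that are bounded above and contain every lower bound of
the set of their upper bounds. -/
structure OrderCut (E : Type*) [Lattice E] where
  carrier : Set E
  nonempty' : carrier.Nonempty
  bddAbove' : BddAbove carrier
  closed' : lowerBounds (upperBounds carrier) ⊆ carrier

namespace OrderCut

section Order

variable {E : Type*} [Lattice E]

instance instSetLike : SetLike (OrderCut E) E where
  coe A := A.carrier
  coe_injective := by
    rintro ⟨a, _⟩ ⟨b, _⟩ h
    have h' : a = b := h
    subst h'
    rfl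

instance instPartialOrder : PartialOrder (OrderCut E) := .ofSetLike (OrderCut E) E

theorem mem_of_forall_le {A : OrderCut E} {x : E} (h : ∀ u ∈ upperBounds (A : Set E), x ≤ u) :
    x ∈ A := A.closed' h

theorem mem_of_le {A : OrderCut E} {x y : E} (hy : y ∈ A) (h : x ≤ y) : x ∈ A :=
  mem_of_forall_le fun _ hu => h.trans (hu hy)

theorem sup_mem {A : OrderCut E} {x y : E} (hx : x ∈ A) (hy : y ∈ A) : x ⊔ y ∈ A :=
  mem_of_forall_le fun _ hu => sup_le (hu hx) (hu hy)

/-- The cut generated by a set. -/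
def cut (S : Set E) (h : S.Nonempty) (hb : BddAbove S) : OrderCut E where
  carrier := lowerBounds (upperBounds S)
  nonempty' := h.mono (subset_lowerBounds_upperBounds S)
  bddAbove' := let ⟨u, hu⟩ := hb; ⟨u, fun _ hx => hx hu⟩
  closed' _ hx _ hu := hx fun _ hy => hy hu

theorem mem_cut_of_mem {S : Set E} {h : S.Nonempty} {hb : BddAbove S} {x : E} (hx : x ∈ S) :
    x ∈ cut S h hb := fun _ hu => hu hx

theorem cut_le_iff {S : Set E} {h : S.Nonempty} {hb : BddAbove S} {A : OrderCut E} :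
    cut S h hb ≤ A ↔ ∀ x ∈ S, x ∈ A :=
  ⟨fun H _ hx => H (mem_cut_of_mem hx), fun H _ hz => mem_of_forall_le fun _ hu =>
    hz fun _ hy => hu (H _ hy)⟩

instance instLattice : Lattice (OrderCut E) where
  sup A B := cut (A ∪ B) (A.nonempty'.mono subset_union_left) (A.bddAbove'.union B.bddAbove')
  le_sup_left _ _ _ hx := mem_cut_of_mem (Or.inl hx)
  le_sup_right _ _ _ hx := mem_cut_of_mem (Or.inr hx)
  sup_le _ _ _ hA hB := cut_le_iff.mpr fun _ hx => hx.elim (fun h => hA h) fun h => hB h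
  inf A B :=
    { carrier := A ∩ B
      nonempty' := by
        obtain ⟨a, ha⟩ := A.nonempty'
        obtain ⟨b, hb⟩ := B.nonempty'
        exact ⟨a ⊓ b, mem_of_le (A := A) ha inf_le_left, mem_of_le (A := B) hb inf_le_right⟩
      bddAbove' := A.bddAbove'.mono inter_subset_left
      closed' := fun _ hx =>
        ⟨A.closed' fun _ hu => hx fun _ hy => hu hy.1,
          B.closed' fun _ hu => hx fun _ hy => hu hy.2⟩ }
  inf_le_left _ _ _ hx := hx.1
  inf_le_right _ _ _ hx := hx.2
  le_inf _ _ _ hB hC _ hx := ⟨hB hx, hC hx⟩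

theorem exists_isLUB (𝒜 : Set (OrderCut E)) (hne : 𝒜.Nonempty) (hb : BddAbove 𝒜) :
    ∃ s, IsLUB 𝒜 s := by
  obtain ⟨B, hB⟩ := hb
  obtain ⟨A, hA⟩ := hne
  refine ⟨cut (⋃ A ∈ 𝒜, (A : Set E)) ?_ ?_, ?_, ?_⟩
  · obtain ⟨a, ha⟩ := A.nonempty'
    exact ⟨a, mem_biUnion hA ha⟩
  · refine B.bddAbove'.mono fun x hx => ?_
    obtain ⟨C, hC, hx⟩ := mem_iUnion₂.mp hx
    exact hB hC hx
  · intro C hC x hx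
    exact mem_cut_of_mem (mem_biUnion hC hx)
  · intro C hC
    refine cut_le_iff.mpr fun x hx => ?_
    obtain ⟨D, hD, hx⟩ := mem_iUnion₂.mp hx
    exact hC hD hx

/-- The cut of all elements below a given one. -/
def principal (x : E) : OrderCut E where
  carrier := Iic x
  nonempty' := ⟨x, le_rfl⟩
  bddAbove' := bddAbove_Iic
  closed' _ hy := hy fun _ hz => hz

theorem mem_principal {x y : E} : y ∈ principal x ↔ y ≤ x := Iff.rfl

theorem principal_le_iff {x : E} {A : OrderCut E} : principal x ≤ A ↔ x ∈ A :=
  ⟨fun h => h (mem_principal.mpr le_rfl), fun h _ hy => mem_of_le h hy⟩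

end Order

section Group

variable {E : Type*} [AddCommGroup E] [Lattice E]

instance instZero : Zero (OrderCut E) := ⟨principal 0⟩

theorem mem_zero {x : E} : x ∈ (0 : OrderCut E) ↔ x ≤ 0 := Iff.rfl

variable [IsOrderedAddMonoid E]

instance instAdd : Add (OrderCut E) where
  add A B := cut (image2 (· + ·) A B) (A.nonempty'.image2 B.nonempty') (by
    obtain ⟨a, ha⟩ := A.bddAbove'
    obtain ⟨b, hb⟩ := B.bddAbove'
    exact ⟨a + b, by rintro _ ⟨x, hx, y, hy, rfl⟩; exact add_le_add (ha hx) (hb hy)⟩)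

instance instNeg : Neg (OrderCut E) where
  neg A :=
    { carrier := {x | -x ∈ upperBounds (A : Set E)}
      nonempty' := let ⟨u, hu⟩ := A.bddAbove'; ⟨-u, by rw [mem_ofPred_eq, neg_neg]; exact hu⟩
      bddAbove' := let ⟨a, ha⟩ := A.nonempty'; ⟨-a, fun _ hx => le_neg_of_le_neg (hx ha)⟩
      closed' := fun _ hx _ ha => le_neg_of_le_neg (hx fun _ hy => le_neg_of_le_neg (hy ha)) }

theorem mem_neg {A : OrderCut E} {x : E} : x ∈ -A ↔ ∀ a ∈ A, a ≤ -x := Iff.rfl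

theorem add_mem_add {A B : OrderCut E} {x y : E} (hx : x ∈ A) (hy : y ∈ B) : x + y ∈ A + B :=
  mem_cut_of_mem (mem_image2_of_mem hx hy)

theorem add_le_iff {A B C : OrderCut E} : A + B ≤ C ↔ ∀ x ∈ A, ∀ y ∈ B, x + y ∈ C :=
  cut_le_iff.trans forall_mem_image2

/-- Translating an upper bound of `D` by `-c` gives an upper bound of `S`. Thus inclusions between
sums of cuts need only be checked on generators. -/
theorem add_mem_of_mem_cut {S : Set E} {h : S.Nonempty} {hb : BddAbove S} {D : OrderCut E}
    {z c : E} (H : ∀ s ∈ S, s + c ∈ D) (hz : z ∈ cut S h hb) : z + c ∈ D :=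
  mem_of_forall_le fun _ hu => le_sub_iff_add_le.mp <|
    hz fun _ hs => le_sub_iff_add_le.mpr (hu (H _ hs))

theorem add_mem_of_mem_cut' {S : Set E} {h : S.Nonempty} {hb : BddAbove S} {D : OrderCut E}
    {z c : E} (H : ∀ s ∈ S, c + s ∈ D) (hz : z ∈ cut S h hb) : c + z ∈ D :=
  mem_of_forall_le fun _ hu => le_sub_iff_add_le'.mp <|
    hz fun _ hs => le_sub_iff_add_le'.mpr (hu (H _ hs))

theorem add_mem_of_mem_add {A B D : OrderCut E} {z c : E} (H : ∀ a ∈ A, ∀ b ∈ B, a + b + c ∈ D)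
    (hz : z ∈ A + B) : z + c ∈ D :=
  add_mem_of_mem_cut (forall_mem_image2.mpr H) hz

protected theorem add_comm (A B : OrderCut E) : A + B = B + A := by
  have H : ∀ A B : OrderCut E, A + B ≤ B + A := fun A B => add_le_iff.mpr fun x hx y hy => by
    rw [add_comm]
    exact add_mem_add hy hx
  exact le_antisymm (H A B) (H B A)

protected theorem add_assoc (A B C : OrderCut E) : A + B + C = A + (B + C) := by
  have H : ∀ A B C : OrderCut E, A + B + C ≤ A + (B + C) := fun A B C =>
    add_le_iff.mpr fun z hz c hc => add_mem_of_mem_add (fun a ha b hb => by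
      rw [add_assoc]
      exact add_mem_add ha (add_mem_add hb hc)) hz
  refine le_antisymm (H A B C) ?_
  rw [OrderCut.add_comm A, OrderCut.add_comm (A + B), OrderCut.add_comm A B,
    OrderCut.add_comm B C]
  exact H C B A

protected theorem zero_add (A : OrderCut E) : 0 + A = A :=
  le_antisymm (add_le_iff.mpr fun _ hx _ hy => mem_of_le hy (add_le_of_nonpos_left hx))
    fun x hx => by simpa using add_mem_add (mem_zero.mpr (le_refl (0 : E))) hx

/-- This is where the Archimedean property enters. If `u` bounds the sums generating `-A + A`, then
`A` is stable under subtraction of `u`; as `A` is bounded above, the multiples of `-u` are too, and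
so `0 ≤ u`. -/
protected theorem neg_add_cancel (hE : IsArchimedeanVL E) (A : OrderCut E) : -A + A = 0 := by
  refine le_antisymm (add_le_iff.mpr fun x hx a ha => ?_) (principal_le_iff.mpr ?_)
  · have := mem_neg.mp hx a ha
    rw [mem_zero]
    simpa using add_le_add_right this x
  · intro u hu
    have step : ∀ a ∈ A, a - u ∈ A := fun a ha => mem_of_forall_le fun b hb => by
      have hb' : -b ∈ -A := mem_neg.mpr fun a ha => by simpa using hb ha
      have := hu (mem_image2_of_mem hb' ha)
      have h2 : a ≤ b + u := by simpa using add_le_add_right this b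
      exact sub_le_iff_le_add.mpr h2
    obtain ⟨a, ha⟩ := A.nonempty'
    obtain ⟨b, hb⟩ := A.bddAbove'
    have steps : ∀ n : ℕ, a + n • (-u) ∈ A := by
      intro n
      induction n with
      | zero =>
        rw [zero_nsmul, add_zero]
        exact ha
      | succ n ih =>
        have := step _ ih
        rwa [succ_nsmul, ← add_assoc, ← sub_eq_add_neg _ u]
    exact neg_nonpos.mp (hE (-u) (b - a) fun n => le_sub_iff_add_le'.mpr (hb (steps n)))

theorem principal_add (x y : E) : principal (x + y) = principal x + principal y :=
  le_antisymm (principal_le_iff.mpr (add_mem_add (mem_principal.mpr le_rfl)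
    (mem_principal.mpr le_rfl))) (add_le_iff.mpr fun _ ha _ hb => add_le_add ha hb)

end Group

section NonnegSMul

variable {E : Type*} [AddCommGroup E] [Lattice E] [Module ℝ E] [IsOrderedModule ℝ E]

open scoped NNReal

theorem nonneg_smul_le_smul (r : ℝ≥0) {x y : E} (h : x ≤ y) : r • x ≤ r • y :=
  smul_le_smul_of_nonneg_left (α := ℝ) h r.2

instance instSMulNNReal : SMul ℝ≥0 (OrderCut E) where
  smul r A := cut ((r • ·) '' A) (A.nonempty'.image _) (by
    obtain ⟨b, hb⟩ := A.bddAbove'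
    exact ⟨r • b, by rintro _ ⟨x, hx, rfl⟩; exact nonneg_smul_le_smul r (hb hx)⟩)

theorem smul_mem_smul {A : OrderCut E} {x : E} (r : ℝ≥0) (hx : x ∈ A) : r • x ∈ r • A :=
  mem_cut_of_mem (mem_image_of_mem _ hx)

theorem smul_le_iff {r : ℝ≥0} {A B : OrderCut E} : r • A ≤ B ↔ ∀ x ∈ A, r • x ∈ B :=
  cut_le_iff.trans forall_mem_image

theorem smul_mem_of_mem_cut {S : Set E} {h : S.Nonempty} {hb : BddAbove S} {D : OrderCut E}
    {z : E} {r : ℝ≥0} (H : ∀ s ∈ S, r • s ∈ D) (hz : z ∈ cut S h hb) : r • z ∈ D := by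
  rcases eq_or_ne r 0 with rfl | hr
  · obtain ⟨s, hs⟩ := h
    simpa using H s hs
  · refine mem_of_forall_le fun u hu => ?_
    have := nonneg_smul_le_smul r (hz (a := r⁻¹ • u) fun s hs => by
      simpa [smul_smul, hr] using nonneg_smul_le_smul r⁻¹ (hu (H s hs)))
    simpa [smul_smul, hr] using this

theorem principal_nnreal_smul (r : ℝ≥0) (x : E) : principal (r • x) = r • principal x :=
  le_antisymm (principal_le_iff.mpr (smul_mem_smul r (mem_principal.mpr le_rfl)))
    (smul_le_iff.mpr fun _ ha => nonneg_smul_le_smul r ha)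

end NonnegSMul

section VectorLattice

variable {E : Type*} [AddCommGroup E] [Lattice E] [IsOrderedAddMonoid E]
  [hE : Fact (IsArchimedeanVL E)]

instance instAddCommGroup : AddCommGroup (OrderCut E) where
  add_assoc := OrderCut.add_assoc
  zero_add := OrderCut.zero_add
  add_zero A := (OrderCut.add_comm A 0).trans (OrderCut.zero_add A)
  nsmul := nsmulRec
  zsmul := zsmulRec
  neg_add_cancel := OrderCut.neg_add_cancel hE.out
  add_comm := OrderCut.add_comm

instance instIsOrderedAddMonoid : IsOrderedAddMonoid (OrderCut E) where
  add_le_add_left _ _ h _ := add_le_iff.mpr fun _ hx _ hy => add_mem_add (h hx) hy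

variable [Module ℝ E] [IsOrderedModule ℝ E]

open scoped NNReal

instance instModuleNNReal : Module ℝ≥0 (OrderCut E) where
  one_smul A := le_antisymm (smul_le_iff.mpr fun x hx => by simpa using hx)
    fun x hx => by simpa using smul_mem_smul 1 hx
  mul_smul r s A := le_antisymm
    (smul_le_iff.mpr fun x hx => by
      rw [mul_smul]
      exact smul_mem_smul r (smul_mem_smul s hx))
    (smul_le_iff.mpr fun x hx => smul_mem_of_mem_cut (forall_mem_image.mpr fun y hy => by
      rw [smul_smul]
      exact smul_mem_smul _ hy) hx)
  smul_zero r := le_antisymm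
    (smul_le_iff.mpr fun x hx => mem_zero.mpr
      (by simpa using nonneg_smul_le_smul r (mem_zero.mp hx)))
    (principal_le_iff.mpr (by simpa using smul_mem_smul r (mem_zero.mpr (le_refl (0 : E)))))
  smul_add r A B := le_antisymm
    (smul_le_iff.mpr fun x hx => smul_mem_of_mem_cut (forall_mem_image2.mpr fun a ha b hb => by
      rw [smul_add]
      exact add_mem_add (smul_mem_smul r ha) (smul_mem_smul r hb)) hx)
    (add_le_iff.mpr fun x hx y hy => add_mem_of_mem_cut (forall_mem_image.mpr fun a ha => by
      refine add_mem_of_mem_cut' (forall_mem_image.mpr fun b hb => ?_) hy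
      simp only [← smul_add]
      exact smul_mem_smul r (add_mem_add ha hb)) hx)
  add_smul r s A := le_antisymm
    (smul_le_iff.mpr fun x hx => by
      rw [add_smul]
      exact add_mem_add (smul_mem_smul r hx) (smul_mem_smul s hx))
    (add_le_iff.mpr fun x hx y hy => add_mem_of_mem_cut (forall_mem_image.mpr fun a ha => by
      refine add_mem_of_mem_cut' (forall_mem_image.mpr fun b hb => ?_) hy
      -- A single element of `A` must serve both summands: `r a + s b ≤ (r + s)(a ⊔ b)`.
      refine mem_of_le (smul_mem_smul (r + s) (sup_mem ha hb)) ?_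
      rw [add_smul]
      exact add_le_add (nonneg_smul_le_smul r le_sup_left) (nonneg_smul_le_smul s le_sup_right))
      hx)
  zero_smul A := le_antisymm
    (smul_le_iff.mpr fun x hx => by simp [mem_zero])
    (principal_le_iff.mpr (by
      obtain ⟨a, ha⟩ := A.nonempty'
      simpa using smul_mem_smul 0 ha))

noncomputable instance instModule : Module ℝ (OrderCut E) := Module.ofNNReal _

theorem smul_eq (r : ℝ) (A : OrderCut E) : r • A = r.toNNReal • A - (-r).toNNReal • A := rfl

theorem smul_of_nonneg {r : ℝ} (hr : 0 ≤ r) (A : OrderCut E) : r • A = r.toNNReal • A := by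
  rw [smul_eq, Real.toNNReal_of_nonpos (neg_nonpos.mpr hr), zero_smul, sub_zero]

instance instIsOrderedModule : IsOrderedModule ℝ (OrderCut E) where
  smul_le_smul_of_nonneg_left r hr A B h := by
    rw [smul_of_nonneg hr, smul_of_nonneg hr]
    exact smul_le_iff.mpr fun x hx => smul_mem_smul _ (h hx)
  smul_le_smul_of_nonneg_right A hA r s h := by
    rw [← sub_nonneg, ← sub_smul, smul_of_nonneg (sub_nonneg.mpr h)]
    refine principal_le_iff.mpr ?_
    simpa using smul_mem_smul (s - r).toNNReal (principal_le_iff.mp hA)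

/-- The embedding of a vector lattice in its lattice of cuts. -/
noncomputable def embedding (E : Type*) [AddCommGroup E] [Lattice E] [IsOrderedAddMonoid E]
    [Fact (IsArchimedeanVL E)] [Module ℝ E] [IsOrderedModule ℝ E] : E →ₗ[ℝ] OrderCut E where
  toFun := principal
  map_add' := principal_add
  map_smul' r x := by
    have h : r • x + (-r).toNNReal • x = r.toNNReal • x := by
      rw [NNReal.smul_def, NNReal.smul_def, ← add_smul, Real.coe_toNNReal', Real.coe_toNNReal']
      congr 1
      linarith [max_zero_sub_max_neg_zero_eq_self r]
    rw [RingHom.id_apply, smul_eq, ← principal_nnreal_smul, ← principal_nnreal_smul,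
      eq_sub_iff_add_eq, ← principal_add, h]

theorem isOrderCompletion_embedding : IsOrderCompletion (embedding E) where
  injective _ _ h := le_antisymm (principal_le_iff.mp h.le) (principal_le_iff.mp h.ge)
  map_sup a b := le_antisymm
    (principal_le_iff.mpr (sup_mem ((le_sup_left : principal a ≤ principal a ⊔ principal b)
      (mem_principal.mpr le_rfl)) ((le_sup_right : principal b ≤ principal a ⊔ principal b)
      (mem_principal.mpr le_rfl))))
    (sup_le (principal_le_iff.mpr le_sup_left) (principal_le_iff.mpr le_sup_right))
  order_complete := exists_isLUB
  order_dense A hA := by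
    obtain ⟨a, ha, ha'⟩ := SetLike.exists_of_lt hA
    refine ⟨a ⊔ 0, lt_of_le_not_ge (principal_le_iff.mpr le_sup_right) fun h => ha' ?_,
      principal_le_iff.mpr (sup_mem ha (hA.le (mem_zero.mpr le_rfl)))⟩
    exact le_sup_left.trans (principal_le_iff.mp h)
  majorizing A := by
    obtain ⟨b, hb⟩ := A.bddAbove'
    exact ⟨b, fun x hx => hb hx⟩

end VectorLattice

end OrderCut

/-! ### Sublattices of spaces of continuous functions -/

namespace VectorSublattice

theorem generate_le {E : Type*} [AddCommGroup E] [Lattice E] [Module ℝ E] {A : Set E}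
    {S : VectorSublattice E} (h : A ⊆ S) : generate A ≤ S := fun _ hx => hx S h

/-- A linear space of continuous functions that is closed under absolute values is a
sublattice. -/
noncomputable def ofAbsMem {K : Type*} [TopologicalSpace K] (S : Submodule ℝ C(K, ℝ))
    (h : ∀ f ∈ S, |f| ∈ S) : VectorSublattice C(K, ℝ) where
  toSubmodule := S
  sup_mem' {a b} ha hb := by
    have e : a ⊔ b = (2⁻¹ : ℝ) • (a + b + |b - a|) := by
      ext t
      simp only [ContinuousMap.sup_apply, ContinuousMap.smul_apply, ContinuousMap.add_apply,
        ContinuousMap.abs_apply, ContinuousMap.sub_apply]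
      exact sup_eq_half_smul_add_add_abs_sub ℝ (a t) (b t)
    rw [e]
    exact S.smul_mem _ (S.add_mem (S.add_mem ha hb) (h _ (S.sub_mem hb ha)))

end VectorSublattice

namespace BallHager

/-! ### Asymptotics at a rational point -/

/-- The trace on `P` of the neighbourhoods of a rational point. -/
abbrev nhdsAt (q : Icc (0 : ℚ) 1) : Filter P := comap Subtype.val (𝓝 (ratPoint q))

theorem pole_apply (q : Icc (0 : ℚ) 1) (t : P) :
    pole q t = 1 / |t.toReal - ((q : ℚ) : ℝ)| := rfl

theorem oscillation_apply (r : ℕ → Icc (0 : ℚ) 1) (t : P) :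
    oscillation r t = ∑' n : ℕ, 1 / 2 ^ (n + 1) * Real.sin (pole (r n) t) := rfl

theorem pole_pos (q : Icc (0 : ℚ) 1) (t : P) : 0 < pole q t :=
  one_div_pos.mpr (lt_of_le_of_ne (abs_nonneg _) (abs_sub_ne_zero q t).symm)

theorem exists_small_sin_inv_eq {s : ℝ} (hs : s ∈ Icc (-1 : ℝ) 1) {ε : ℝ} (hε : 0 < ε) :
    ∃ d : ℝ, 0 < d ∧ d < ε ∧ Real.sin (1 / d) = s := by
  -- Adding `k` periods to `arcsin s ≥ -π/2` makes the argument of the sine exceed `1/ε`.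
  obtain ⟨k, hk⟩ := exists_nat_gt (1 / ε + 1)
  have h0 : 0 < 1 / ε := by positivity
  have h1 := Real.neg_pi_div_two_le_arcsin s
  have h2 := Real.pi_gt_three
  have h3 : 1 / ε < Real.arcsin s + k * (2 * Real.pi) := by nlinarith
  refine ⟨1 / (Real.arcsin s + k * (2 * Real.pi)), one_div_pos.mpr (h0.trans h3),
    (one_div_lt hε (h0.trans h3)).mp h3, ?_⟩
  rw [one_div_one_div, Real.sin_add_nat_mul_two_pi, Real.sin_arcsin hs.1 hs.2]

/-- Some point of `[0,1]` arbitrarily close to `q` has sine exactly `s`: a distance below `1/2` fits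
on one side of `q`. That point may be rational, so it is replaced by a nearby irrational one. -/
theorem mapClusterPt_sin_pole (q : Icc (0 : ℚ) 1) {s : ℝ} (hs : s ∈ Icc (-1 : ℝ) 1) :
    MapClusterPt s (nhdsAt q) fun t => Real.sin (pole q t) := by
  rw [mapClusterPt_iff_frequently]
  intro U hU
  rw [frequently_iff]
  intro V hV
  obtain ⟨V', hV', hVV⟩ := mem_comap.mp hV
  obtain ⟨W, hWV, hW, hqW⟩ := mem_nhds_iff.mp hV'
  obtain ⟨ε, hε, hball⟩ := Metric.isOpen_iff.mp hW _ hqW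
  obtain ⟨d, hd, hdε, hds⟩ := exists_small_sin_inv_eq hs
    (lt_min hε (show (0 : ℝ) < 1 / 2 by norm_num))
  obtain ⟨hdε, hd2⟩ := lt_min_iff.mp hdε
  have hq : (0 : ℝ) ≤ ((q : ℚ) : ℝ) ∧ ((q : ℚ) : ℝ) ≤ 1 := (ratPoint q).2
  obtain ⟨x, hx⟩ : ∃ x : Icc (0 : ℝ) 1, |(x : ℝ) - ((q : ℚ) : ℝ)| = d := by
    rcases le_total ((q : ℚ) : ℝ) (1 / 2) with h | h
    · exact ⟨⟨(q : ℚ) + d, by linarith, by linarith⟩, by simp [abs_of_pos hd]⟩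
    · exact ⟨⟨(q : ℚ) - d, by linarith, by linarith⟩, by simp [abs_of_pos hd]⟩
  have hxW : x ∈ W := hball (by
    rw [Metric.mem_ball, Subtype.dist_eq, Real.dist_eq]
    exact hx.trans_lt hdε)
  have hc : ContinuousAt (fun x : Icc (0 : ℝ) 1 => Real.sin (1 / |(x : ℝ) - ((q : ℚ) : ℝ)|)) x := by
    refine Real.continuous_sin.continuousAt.comp (continuousAt_const.div ?_ ?_)
    · fun_prop
    · rw [hx]
      exact hd.ne'
  have hU' : U ∈ 𝓝 (Real.sin (1 / |(x : ℝ) - ((q : ℚ) : ℝ)|)) := by rwa [hx, hds]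
  obtain ⟨_, ⟨hyW, hyU⟩, t, rfl⟩ := mem_closure_iff_nhds.mp (isDenseInducing_val.dense x) _
    (inter_mem (hW.mem_nhds hxW) (hc hU'))
  exact ⟨t, hVV (hWV hyW), hyU⟩

theorem exists_ultrafilter (q : Icc (0 : ℚ) 1) {s : ℝ} (hs : s ∈ Icc (-1 : ℝ) 1) :
    ∃ U : Ultrafilter P, ↑U ≤ nhdsAt q ∧ Tendsto (fun t => Real.sin (pole q t)) U (𝓝 s) :=
  mapClusterPt_iff_ultrafilter.mp (mapClusterPt_sin_pole q hs)

/-- Up to an error that tends to zero at `q`, the function `f` is a multiple of the pole at `q`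
plus a continuous function of its sine. -/
def HasProfileAt (f : C(P, ℝ)) (q : Icc (0 : ℚ) 1) (a : ℝ) (φ : C(ℝ, ℝ)) : Prop :=
  Tendsto (fun t => f t - a * pole q t - φ (Real.sin (pole q t))) (nhdsAt q) (𝓝 0)

/-! ### Calculus with profiles -/

section Profile

variable {f g : C(P, ℝ)} {q : Icc (0 : ℚ) 1} {a b : ℝ} {φ ψ : C(ℝ, ℝ)}

theorem hasProfileAt_zero : HasProfileAt 0 q 0 0 := by
  simpa [HasProfileAt] using tendsto_const_nhds

theorem HasProfileAt.add (hf : HasProfileAt f q a φ) (hg : HasProfileAt g q b ψ) :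
    HasProfileAt (f + g) q (a + b) (φ + ψ) := by
  have h := Tendsto.add hf hg
  rw [add_zero] at h
  refine h.congr fun t => ?_
  simp only [ContinuousMap.add_apply]
  ring

theorem HasProfileAt.smul (c : ℝ) (hf : HasProfileAt f q a φ) :
    HasProfileAt (c • f) q (c * a) (c • φ) := by
  have h := Tendsto.const_mul c hf
  rw [mul_zero] at h
  refine h.congr fun t => ?_
  simp only [ContinuousMap.smul_apply, smul_eq_mul]
  ring

theorem HasProfileAt.sub (hf : HasProfileAt f q a φ) (hg : HasProfileAt g q b ψ) :
    HasProfileAt (f - g) q (a - b) (φ - ψ) := by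
  have h := Tendsto.sub hf hg
  rw [sub_zero] at h
  refine h.congr fun t => ?_
  simp only [ContinuousMap.sub_apply]
  ring

theorem HasLimitAt.exists_hasProfileAt (h : HasLimitAt (f - a • pole q) (ratPoint q)) :
    ∃ l : ℝ, HasProfileAt f q a (ContinuousMap.const ℝ l) := by
  obtain ⟨l, hl⟩ := h
  refine ⟨l, ?_⟩
  have h := Tendsto.sub_const hl l
  rw [sub_self] at h
  exact h

theorem HasProfileAt.eventually_nonneg (hf : HasProfileAt f q a φ) (ha : 0 < a) :
    ∀ᶠ t in nhdsAt q, 0 ≤ f t := by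
  obtain ⟨C, hC⟩ := isCompact_Icc.exists_bound_of_continuousOn
    (s := Icc (-1 : ℝ) 1) φ.continuous.continuousOn
  filter_upwards [hf.eventually (Ioi_mem_nhds neg_one_lt_zero),
    ((tendsto_pole q).const_mul_atTop ha).eventually_ge_atTop (C + 1)] with t h1 h2
  have h3 := (abs_le.mp (hC _ ⟨Real.neg_one_le_sin (pole q t), Real.sin_le_one _⟩)).1
  linarith

theorem HasProfileAt.exists_abs (hf : HasProfileAt f q a φ) :
    ∃ ψ, HasProfileAt |f| q |a| ψ := by
  rcases lt_trichotomy a 0 with h | rfl | h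
  · have hf' := hf.smul (-1)
    refine ⟨(-1 : ℝ) • φ, hf'.congr' ?_⟩
    filter_upwards [hf'.eventually_nonneg (by linarith)] with t ht
    have ht' : f t ≤ 0 := by simpa using ht
    rw [ContinuousMap.abs_apply, abs_of_nonpos ht', abs_of_neg h]
    simp
  · refine ⟨|φ|, squeeze_zero_norm (fun t => ?_) (tendsto_zero_iff_norm_tendsto_zero.mp hf)⟩
    simpa using abs_abs_sub_abs_le (f t) (φ (Real.sin (pole q t)))
  · refine ⟨φ, hf.congr' ?_⟩
    filter_upwards [hf.eventually_nonneg h] with t ht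
    rw [ContinuousMap.abs_apply, abs_of_nonneg ht, abs_of_pos h]

/-- Along `l` the difference `f - a p` has the finite limit `φ s`, while `p` tends to infinity; so a
bounded `f` has `a = 0` and tends to `φ s`. -/
theorem HasProfileAt.eq_zero_of_bounded {l : Filter P} [l.NeBot] (hl : l ≤ nhdsAt q) {s M : ℝ}
    (hs : Tendsto (fun t => Real.sin (pole q t)) l (𝓝 s)) (hf : HasProfileAt f q a φ)
    (hM : ∀ᶠ t in l, |f t| ≤ M) : a = 0 ∧ |φ s| ≤ M := by
  have h1 : Tendsto (fun t => f t - a * pole q t) l (𝓝 (φ s)) := by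
    have h := (hf.mono_left hl).add ((φ.continuous.tendsto s).comp hs)
    rw [zero_add] at h
    exact h.congr fun t => by simp
  have ha : a = 0 := by
    by_contra ha
    have h2 := ((tendsto_pole q).mono_left hl).const_mul_atTop (abs_pos.mpr ha)
    obtain ⟨t, ht1, ht2, ht3⟩ := (hM.and ((h1.abs.eventually (Iio_mem_nhds (lt_add_one _))).and
      (h2.eventually_ge_atTop (M + (|φ s| + 1))))).exists
    have h3 : |a| * pole q t ≤ |f t| + |f t - a * pole q t| := by
      rw [← abs_of_pos (pole_pos q t), ← abs_mul, abs_of_pos (pole_pos q t)]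
      simpa using abs_sub (f t) (f t - a * pole q t)
    linarith
  subst ha
  simp only [zero_mul, sub_zero] at h1
  exact ⟨rfl, le_of_tendsto h1.abs hM⟩

/-- With `M = 0` this is uniqueness of the profile. Only `[-1,1]` matters, since `φ` is evaluated at
sines. -/
theorem HasProfileAt.eq_of_bounded_sub (hf : HasProfileAt f q a φ) (hg : HasProfileAt g q b ψ)
    {M : ℝ} (hM : ∀ᶠ t in nhdsAt q, |f t - g t| ≤ M) :
    a = b ∧ ∀ s ∈ Icc (-1 : ℝ) 1, |φ s - ψ s| ≤ M := by
  have H : ∀ s ∈ Icc (-1 : ℝ) 1, a - b = 0 ∧ |(φ - ψ) s| ≤ M := by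
    intro s hs
    obtain ⟨U, hU, hUs⟩ := exists_ultrafilter q hs
    exact (hf.sub hg).eq_zero_of_bounded hU hUs (hU hM)
  exact ⟨sub_eq_zero.mp (H 0 ⟨by norm_num, by norm_num⟩).1, fun s hs => (H s hs).2⟩

theorem HasProfileAt.hasLimitAt (hf : HasProfileAt f q a φ) {l : ℝ}
    (h : ∀ s ∈ Icc (-1 : ℝ) 1, φ s = l) : HasLimitAt (f - a • pole q) (ratPoint q) := by
  refine ⟨l, ?_⟩
  have h1 := Tendsto.add_const l hf
  rw [zero_add] at h1
  refine h1.congr fun t => ?_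
  rw [h _ ⟨Real.neg_one_le_sin _, Real.sin_le_one _⟩]
  simp

end Profile

/-! ### The profiles of `g` and of the elements of `X` and `Y` -/

theorem summable_half_pow : Summable fun n : ℕ => (1 : ℝ) / 2 ^ (n + 1) := by
  refine (summable_geometric_two.mul_left (1 / 2)).congr fun n => ?_
  rw [one_div_pow, pow_succ]
  field_simp

theorem norm_half_pow_mul_sin_le (n : ℕ) (x : ℝ) :
    ‖1 / 2 ^ (n + 1) * Real.sin x‖ ≤ 1 / 2 ^ (n + 1) := by
  rw [norm_mul, Real.norm_eq_abs, Real.norm_eq_abs, abs_of_pos (by positivity)]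
  exact mul_le_of_le_one_right (by positivity) (Real.abs_sin_le_one x)

theorem summable_half_pow_mul_sin (x : ℕ → ℝ) :
    Summable fun n : ℕ => 1 / 2 ^ (n + 1) * Real.sin (x n) :=
  Summable.of_norm_bounded summable_half_pow fun n => norm_half_pow_mul_sin_le n (x n)

/-- By injectivity all other terms have their poles elsewhere and converge at `r n`; dominated
convergence sums their limits to `c`. The `n`-th term is the linear part of the profile. -/
theorem exists_hasProfileAt_oscillation {r : ℕ → Icc (0 : ℚ) 1} (hr : Function.Injective r)
    (n : ℕ) : ∃ c : ℝ, HasProfileAt (oscillation r) (r n) 0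
      (ContinuousMap.const ℝ c + (1 / 2 ^ (n + 1) : ℝ) • ContinuousMap.id ℝ) := by
  have hlim : ∀ k, k ≠ n → ∃ l, Tendsto (pole (r k)) (nhdsAt (r n)) (𝓝 l) := fun k hk =>
    hasLimitAt_pole fun h => hk (hr (Subtype.ext (Rat.cast_injective (α := ℝ) h.symm)))
  choose! L hL using hlim
  have h := tendsto_tsum_of_dominated_convergence (𝓕 := nhdsAt (r n))
    (f := fun t k => if k = n then 0 else 1 / 2 ^ (k + 1) * Real.sin (pole (r k) t))
    (g := fun k => if k = n then 0 else 1 / 2 ^ (k + 1) * Real.sin (L k))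
    summable_half_pow (fun k => by
      by_cases hk : k = n
      · simp only [hk, if_true]
        exact tendsto_const_nhds
      · simp only [hk, if_false]
        exact ((Real.continuous_sin.tendsto _).comp (hL k hk)).const_mul _)
    (Eventually.of_forall fun t k => by
      by_cases hk : k = n
      · simp only [hk, if_true, norm_zero]
        positivity
      · simp only [hk, if_false]
        exact norm_half_pow_mul_sin_le _ _)
  refine ⟨∑' k, if k = n then 0 else 1 / 2 ^ (k + 1) * Real.sin (L k), ?_⟩
  have h' := h.sub_const (∑' k, if k = n then 0 else 1 / 2 ^ (k + 1) * Real.sin (L k))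
  rw [sub_self] at h'
  refine h'.congr fun t => ?_
  rw [oscillation_apply, (summable_half_pow_mul_sin fun k => pole (r k) t).tsum_eq_add_tsum_ite n]
  simp only [ContinuousMap.add_apply, ContinuousMap.const_apply, ContinuousMap.smul_apply,
    ContinuousMap.id_apply, smul_eq_mul]
  ring

/-- The functions with a profile at every rational point, and with only finitely many poles. -/
noncomputable def profiled : VectorSublattice C(P, ℝ) :=
  VectorSublattice.ofAbsMem
    { carrier := {f | ∃ α : Icc (0 : ℚ) 1 →₀ ℝ, ∀ q, ∃ φ, HasProfileAt f q (α q) φ}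
      add_mem' := by
        rintro f g ⟨α, hα⟩ ⟨β, hβ⟩
        refine ⟨α + β, fun q => ?_⟩
        obtain ⟨φ, hφ⟩ := hα q
        obtain ⟨ψ, hψ⟩ := hβ q
        exact ⟨φ + ψ, hφ.add hψ⟩
      zero_mem' := ⟨0, fun q => ⟨0, hasProfileAt_zero⟩⟩
      smul_mem' := by
        rintro c f ⟨α, hα⟩
        refine ⟨c • α, fun q => ?_⟩
        obtain ⟨φ, hφ⟩ := hα q
        exact ⟨c • φ, hφ.smul c⟩ }
    (by
      rintro f ⟨α, hα⟩
      refine ⟨α.mapRange (fun c => |c|) abs_zero, fun q => ?_⟩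
      obtain ⟨φ, hφ⟩ := hα q
      rw [Finsupp.mapRange_apply]
      exact hφ.exists_abs)

theorem mem_lattice_iff {f : C(P, ℝ)} : f ∈ lattice ↔
    ∃ α : Icc (0 : ℚ) 1 →₀ ℝ, ∀ q, ∃ l : ℝ, HasProfileAt f q (α q) (ContinuousMap.const ℝ l) :=
  mem_space_iff.trans <| exists_congr fun _ => forall_congr' fun _ =>
    ⟨fun h => h.exists_hasProfileAt, fun ⟨_, h⟩ => h.hasLimitAt fun _ _ => rfl⟩

theorem extension_le {r : ℕ → Icc (0 : ℚ) 1} {S : VectorSublattice C(P, ℝ)} (hX : lattice ≤ S)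
    (hg : oscillation r ∈ S) : extension r ≤ S :=
  VectorSublattice.generate_le (insert_subset hg hX)

theorem oscillation_mem_extension (r : ℕ → Icc (0 : ℚ) 1) : oscillation r ∈ extension r :=
  VectorSublattice.subset_generate _ (mem_insert _ _)

theorem lattice_le_profiled : lattice ≤ profiled := fun _ hf =>
  let ⟨α, hα⟩ := mem_lattice_iff.mp hf
  ⟨α, fun q => let ⟨_, hl⟩ := hα q; ⟨_, hl⟩⟩

theorem extension_le_profiled (r : ℕ ≃ Icc (0 : ℚ) 1) : extension r ≤ profiled := by
  refine extension_le lattice_le_profiled ⟨0, fun q => ?_⟩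
  obtain ⟨n, rfl⟩ := r.surjective q
  obtain ⟨c, hc⟩ := exists_hasProfileAt_oscillation r.injective n
  exact ⟨_, hc⟩

/-- Where `f = x + c g` with `x` in the lattice and `c ≠ 0`, the function `f` oscillates. -/
theorem eq_zero_of_eventually_eq {r : ℕ ≃ Icc (0 : ℚ) 1} {q : Icc (0 : ℚ) 1} {f x : C(P, ℝ)}
    {a l c : ℝ} (hf : HasProfileAt f q a (ContinuousMap.const ℝ l)) (hx : x ∈ lattice)
    (h : ∀ᶠ t in nhdsAt q, f t = x t + c * oscillation r t) : c = 0 := by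
  obtain ⟨n, rfl⟩ := r.surjective q
  obtain ⟨d, hd⟩ := exists_hasProfileAt_oscillation r.injective n
  obtain ⟨α, hα⟩ := mem_lattice_iff.mp hx
  obtain ⟨l', hl'⟩ := hα (r n)
  have H := (hf.eq_of_bounded_sub (hl'.add (hd.smul c)) (M := 0) (by
    filter_upwards [h] with t ht
    simp [ht])).2
  have h1 := H 1 ⟨by norm_num, le_rfl⟩
  have h2 := H (-1) ⟨le_rfl, by norm_num⟩
  simp only [ContinuousMap.add_apply, ContinuousMap.const_apply, ContinuousMap.smul_apply,
    ContinuousMap.id_apply, smul_eq_mul, abs_nonpos_iff] at h1 h2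
  have h3 : c * (1 / 2 ^ (n + 1)) = 0 := by linarith
  exact (mul_eq_zero.mp h3).resolve_right (by positivity)

theorem oscillation_notMem_lattice (r : ℕ ≃ Icc (0 : ℚ) 1) : oscillation r ∉ lattice := by
  intro h
  obtain ⟨α, hα⟩ := mem_lattice_iff.mp h
  obtain ⟨l, hl⟩ := hα (r 0)
  exact one_ne_zero (eq_zero_of_eventually_eq (r := r) (c := 1) hl (zero_mem lattice)
    (Eventually.of_forall fun t => by simp))

end BallHager

/-- If finitely many closed sets cover a nonempty open set, then one of them contains a nonempty
open part of it. -/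
theorem Set.Finite.exists_isOpen_subset_of_cover {K ι : Type*} [TopologicalSpace K] {A : Set ι}
    (hA : A.Finite) {C : ι → Set K} (hC : ∀ i, IsClosed (C i)) {U : Set K} (hU : IsOpen U)
    (hne : U.Nonempty) (hcov : ∀ t ∈ U, ∃ i ∈ A, t ∈ C i) :
    ∃ i ∈ A, ∃ V, IsOpen V ∧ V.Nonempty ∧ V ⊆ C i ∧ V ⊆ U := by
  induction A, hA using Set.Finite.induction_on generalizing U with
  | empty =>
    obtain ⟨t, ht⟩ := hne
    obtain ⟨i, hi, -⟩ := hcov t ht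
    exact absurd hi (notMem_empty i)
  | @insert a A _ _ ih =>
    by_cases h : U ⊆ C a
    · exact ⟨a, mem_insert _ _, U, hU, hne, h, Subset.rfl⟩
    · obtain ⟨i, hi, V, hV, hVne, hVC, hVU⟩ := ih (hU.sdiff (hC a)) (sdiff_nonempty.mpr h)
        fun t ht => by
          obtain ⟨i, hi, hti⟩ := hcov t ht.1
          exact ⟨i, hi.resolve_left fun h => ht.2 (h ▸ hti), hti⟩
      exact ⟨i, mem_insert_of_mem _ hi, V, hV, hVne, hVC, hVU.trans sdiff_subset⟩

namespace BallHager

/-! ### Uniform closedness -/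

theorem denseRange_ratPoint : DenseRange ratPoint := by
  intro x
  rw [Metric.mem_closure_iff]
  intro ε hε
  have hx0 := x.2.1
  have hx1 := x.2.2
  obtain ⟨y, h1, h2⟩ := exists_rat_btwn
    (show max 0 ((x : ℝ) - ε) < min 1 ((x : ℝ) + ε) by
      rw [max_lt_iff, lt_min_iff, lt_min_iff]
      refine ⟨⟨?_, ?_⟩, ?_, ?_⟩ <;> linarith)
  rw [max_lt_iff] at h1
  rw [lt_min_iff] at h2
  refine ⟨ratPoint ⟨y, by exact_mod_cast h1.1.le, by exact_mod_cast h2.1.le⟩, ⟨_, rfl⟩, ?_⟩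
  rw [Subtype.dist_eq, Real.dist_eq, abs_lt]
  change -ε < (x : ℝ) - (y : ℝ) ∧ (x : ℝ) - (y : ℝ) < ε
  constructor <;> linarith [h1.2, h2.2]

/-- A nonempty open subset of `P` is a neighbourhood of rational points outside any given finite
set. -/
theorem exists_mem_nhdsAt {U : Set P} (hU : IsOpen U) (hne : U.Nonempty)
    {F : Set (Icc (0 : ℚ) 1)} (hF : F.Finite) : ∃ q ∉ F, U ∈ nhdsAt q := by
  obtain ⟨V, hV, rfl⟩ := isOpen_induced_iff.mp hU
  obtain ⟨t, ht⟩ := hne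
  have ht' : (t : Icc (0 : ℝ) 1) ∈ V \ ratPoint '' F := by
    refine ⟨ht, ?_⟩
    rintro ⟨q, -, hq⟩
    exact t.2.ne_rat q (congrArg Subtype.val hq).symm
  obtain ⟨q, hq⟩ := denseRange_ratPoint.exists_mem_open
    (hV.sdiff (hF.image ratPoint).isClosed) ⟨_, ht'⟩
  exact ⟨q, fun h => hq.2 (mem_image_of_mem _ h), preimage_mem_comap (hV.mem_nhds hq.1)⟩

/-- The functions that agree at every point with one of finitely many functions `x + c g`. -/
noncomputable def piecewise (g : C(P, ℝ)) : VectorSublattice C(P, ℝ) :=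
  VectorSublattice.ofAbsMem
    { carrier := {f | ∃ A : Set (C(P, ℝ) × ℝ), A.Finite ∧ (∀ p ∈ A, p.1 ∈ lattice) ∧
        ∀ t, ∃ p ∈ A, f t = p.1 t + p.2 * g t}
      add_mem' := by
        rintro f h ⟨A, hA, hAX, hfA⟩ ⟨B, hB, hBX, hhB⟩
        refine ⟨image2 (· + ·) A B, hA.image2 _ hB, ?_, fun t => ?_⟩
        · rintro _ ⟨p, hp, p', hp', rfl⟩
          exact add_mem (hAX p hp) (hBX p' hp')
        · obtain ⟨p, hp, h1⟩ := hfA t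
          obtain ⟨p', hp', h2⟩ := hhB t
          refine ⟨_, mem_image2_of_mem hp hp', ?_⟩
          simp only [ContinuousMap.add_apply, Prod.fst_add, Prod.snd_add, h1, h2]
          ring
      zero_mem' := ⟨{0}, finite_singleton _, by
        rintro _ rfl
        exact zero_mem lattice, fun t => ⟨0, rfl, by simp⟩⟩
      smul_mem' := by
        rintro c f ⟨A, hA, hAX, hfA⟩
        refine ⟨(c • ·) '' A, hA.image _, ?_, fun t => ?_⟩
        · rintro _ ⟨p, hp, rfl⟩
          exact SMulMemClass.smul_mem (S := VectorSublattice C(P, ℝ)) c (hAX p hp)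
        · obtain ⟨p, hp, h1⟩ := hfA t
          refine ⟨_, mem_image_of_mem _ hp, ?_⟩
          simp only [ContinuousMap.smul_apply, Prod.smul_fst, Prod.smul_snd, h1, smul_eq_mul]
          ring }
    (by
      rintro f ⟨A, hA, hAX, hfA⟩
      refine ⟨A ∪ (fun p => -p) '' A, hA.union (hA.image _), ?_, fun t => ?_⟩
      · rintro _ (hp | ⟨p, hp, rfl⟩)
        · exact hAX _ hp
        · exact neg_mem (hAX p hp)
      · obtain ⟨p, hp, h1⟩ := hfA t
        rcases abs_choice (f t) with h | h
        · exact ⟨p, Or.inl hp, (ContinuousMap.abs_apply f t).trans (h.trans h1)⟩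
        · refine ⟨-p, Or.inr (mem_image_of_mem _ hp), ?_⟩
          rw [ContinuousMap.abs_apply, h, h1]
          simp only [Prod.fst_neg, Prod.snd_neg, ContinuousMap.neg_apply]
          ring)

theorem extension_le_piecewise (r : ℕ → Icc (0 : ℚ) 1) :
    extension r ≤ piecewise (oscillation r) := by
  refine extension_le (fun x hx => ⟨{(x, 0)}, finite_singleton _, ?_, fun t => ⟨_, rfl, by simp⟩⟩)
    ⟨{(0, 1)}, finite_singleton _, ?_, fun t => ⟨_, rfl, by simp⟩⟩
  · rintro _ rfl
    exact hx
  · rintro _ rfl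
    exact zero_mem lattice

/-- A function in `Y` that oscillates only at finitely many rational points agrees at every point
with one of finitely many functions in `X`. -/
theorem exists_finite_lattice_cover {r : ℕ ≃ Icc (0 : ℚ) 1} {f : C(P, ℝ)} (hf : f ∈ extension r)
    {F : Set (Icc (0 : ℚ) 1)} (hF : F.Finite)
    (h : ∀ q ∉ F, ∃ a l, HasProfileAt f q a (ContinuousMap.const ℝ l)) :
    ∃ A : Set C(P, ℝ), A.Finite ∧ A ⊆ lattice ∧ ∀ t, ∃ x ∈ A, f t = x t := by
  obtain ⟨A, hA, hAX, hfA⟩ := extension_le_piecewise r hf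
  refine ⟨Prod.fst '' {p ∈ A | p.2 = 0}, (hA.subset (sep_subset _ _)).image _, ?_, ?_⟩
  · rintro _ ⟨p, hp, rfl⟩
    exact hAX p hp.1
  by_contra! hcon
  obtain ⟨t₀, ht₀⟩ := hcon
  -- On this open set `f` differs from all pieces with `c = 0`. If it is nonempty, some piece with
  -- `c ≠ 0` holds on an open part of it, hence near a rational point outside `F`, where `f` does
  -- not oscillate.
  have hU : IsOpen (⋂ p ∈ {p ∈ A | p.2 = 0}, {t | f t = p.1 t}ᶜ) :=
    (hA.subset (sep_subset _ _)).isOpen_biInter fun p _ =>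
      (isClosed_eq f.continuous p.1.continuous).isOpen_compl
  obtain ⟨p, hp, V, hV, hVne, hVC, -⟩ :=
    (hA.subset (sep_subset A fun p => p.2 ≠ 0)).exists_isOpen_subset_of_cover
      (C := fun p => {t | f t = p.1 t + p.2 * oscillation r t})
      (fun p => isClosed_eq f.continuous
        (p.1.continuous.add (continuous_const.mul (oscillation r).continuous)))
      hU ⟨t₀, mem_iInter₂.mpr fun p hp => ht₀ _ (mem_image_of_mem _ hp)⟩ (fun t ht => by
        obtain ⟨p, hp, hpt⟩ := hfA t
        refine ⟨p, ⟨hp, fun h0 => mem_iInter₂.mp ht p ⟨hp, h0⟩ ?_⟩, hpt⟩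
        simpa [h0] using hpt)
  obtain ⟨q, hq, hVq⟩ := exists_mem_nhdsAt hV hVne hF
  obtain ⟨a, l, hal⟩ := h q hq
  exact hp.2 (eq_zero_of_eventually_eq hal (hAX p hp.1) (mem_of_superset hVq hVC))

/-- An ultrafilter along which the sine tends to `s` selects one `x` in the finite set `A`, so `φ s`
is the constant of that `x`. A connected set of finitely many reals is at most a point. -/
theorem HasProfileAt.eq_const_of_finite_cover {f : C(P, ℝ)} {q : Icc (0 : ℚ) 1} {a : ℝ}
    {φ : C(ℝ, ℝ)} (hf : HasProfileAt f q a φ) {A : Set C(P, ℝ)} (hA : A.Finite)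
    (hAX : A ⊆ lattice) (hfA : ∀ t, ∃ x ∈ A, f t = x t) :
    ∃ l, HasProfileAt f q a (ContinuousMap.const ℝ l) := by
  have hx : ∀ x : C(P, ℝ), ∃ b l, x ∈ lattice → HasProfileAt x q b (ContinuousMap.const ℝ l) := by
    intro x
    by_cases hx : x ∈ lattice
    · obtain ⟨α, hα⟩ := mem_lattice_iff.mp hx
      obtain ⟨l, hl⟩ := hα q
      exact ⟨α q, l, fun _ => hl⟩
    · exact ⟨0, 0, fun h => absurd h hx⟩
  choose b l hbl using hx
  have hsub : φ '' Icc (-1) 1 ⊆ l '' A := by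
    rintro _ ⟨s, hs, rfl⟩
    obtain ⟨U, hU, hUs⟩ := exists_ultrafilter q hs
    obtain ⟨x, hxA, hxU⟩ := (Ultrafilter.eventually_exists_mem_iff hA).mp
      (Eventually.of_forall (f := (U : Filter P)) hfA)
    refine ⟨x, hxA, ?_⟩
    have := ((hf.sub (hbl x (hAX hxA))).eq_zero_of_bounded hU hUs (M := 0) (by
      filter_upwards [hxU] with t ht
      simp [ht])).2
    exact (sub_eq_zero.mp (abs_nonpos_iff.mp this)).symm
  have hconn : IsPreconnected (φ '' Icc (-1) 1) :=
    isPreconnected_Icc.image _ φ.continuous.continuousOn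
  have hsing : (φ '' Icc (-1) 1).Subsingleton := by
    by_contra h
    exact hconn.infinite_of_nontrivial (not_subsingleton_iff.mp h) ((hA.image l).subset hsub)
  have h0 : (0 : ℝ) ∈ Icc (-1 : ℝ) 1 := ⟨by norm_num, by norm_num⟩
  refine ⟨φ 0, hf.congr fun t => ?_⟩
  rw [hsing (mem_image_of_mem φ ⟨Real.neg_one_le_sin (pole q t), Real.sin_le_one _⟩)
    (mem_image_of_mem φ h0), ContinuousMap.const_apply]

theorem isUniformlyClosed_lattice (r : ℕ ≃ Icc (0 : ℚ) 1) :
    IsUniformlyClosed {y : extension r | (y : C(P, ℝ)) ∈ lattice} := by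
  rintro ι _ _ _ x y hx ⟨e, he, hconv⟩
  have hconv' : ∀ ε : ℝ, 0 < ε → ∃ z ∈ lattice, ∀ t, |z t - (y : C(P, ℝ)) t| ≤
      ε * (e : C(P, ℝ)) t := by
    intro ε hε
    obtain ⟨i, hi⟩ := hconv ε hε
    exact ⟨x i, hx i, fun t => (hi i le_rfl : |(x i : C(P, ℝ)) - y| ≤ ε • (e : C(P, ℝ))) t⟩
  obtain ⟨α, hα⟩ := extension_le_profiled r y.2
  obtain ⟨β, hβ⟩ := extension_le_profiled r e.2
  have key : ∀ q ∉ (β.support : Set (Icc (0 : ℚ) 1)), ∃ a l,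
      HasProfileAt (y : C(P, ℝ)) q a (ContinuousMap.const ℝ l) := by
    intro q hq
    obtain ⟨φ, hφ⟩ := hα q
    obtain ⟨ψ, hψ⟩ := hβ q
    rw [Finset.mem_coe, Finsupp.notMem_support_iff] at hq
    rw [hq] at hψ
    obtain ⟨C, hC⟩ := isCompact_Icc.exists_bound_of_continuousOn
      (s := Icc (-1 : ℝ) 1) ψ.continuous.continuousOn
    have he : ∀ᶠ t in nhdsAt q, (e : C(P, ℝ)) t ≤ C + 1 := by
      filter_upwards [hψ.eventually (Iio_mem_nhds one_pos)] with t h1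
      have h2 := (abs_le.mp (hC _ ⟨Real.neg_one_le_sin (pole q t), Real.sin_le_one _⟩)).2
      linarith
    have hCpos : 0 < C + 1 := by
      have := (norm_nonneg _).trans (hC 0 ⟨by norm_num, by norm_num⟩)
      linarith
    have hconst : ∀ s ∈ Icc (-1 : ℝ) 1, φ s = φ 0 := by
      intro s hs
      refine eq_of_forall_dist_le fun δ hδ => ?_
      -- As `e ≤ C + 1` near `q`, this choice puts `φ` within `δ/2` of the constant of `z`, both at
      -- `s` and at `0`.
      obtain ⟨z, hz, hzy⟩ := hconv' (δ / 2 / (C + 1)) (by positivity)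
      obtain ⟨γ, hγ⟩ := mem_lattice_iff.mp hz
      obtain ⟨l, hl⟩ := hγ q
      have H := (hφ.eq_of_bounded_sub hl (M := δ / 2) (by
        filter_upwards [he] with t ht
        rw [abs_sub_comm]
        refine (hzy t).trans ?_
        calc δ / 2 / (C + 1) * (e : C(P, ℝ)) t ≤ δ / 2 / (C + 1) * (C + 1) := by gcongr
          _ = δ / 2 := div_mul_cancel₀ _ hCpos.ne')).2
      have h1 := H s hs
      have h2 := H 0 ⟨by norm_num, by norm_num⟩
      rw [ContinuousMap.const_apply] at h1 h2
      rw [Real.dist_eq]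
      calc |φ s - φ 0| ≤ |φ s - l| + |φ 0 - l| := by
            rw [abs_sub_comm (φ 0) l]
            exact abs_sub_le _ _ _
        _ ≤ δ := by linarith
    exact ⟨α q, (hφ.hasLimitAt hconst).exists_hasProfileAt⟩
  obtain ⟨A, hA, hAX, hyA⟩ := exists_finite_lattice_cover y.2 β.support.finite_toSet key
  refine mem_lattice_iff.mpr ⟨α, fun q => ?_⟩
  obtain ⟨φ, hφ⟩ := hα q
  exact hφ.eq_const_of_finite_cover hA hAX hyA

end BallHager

/-! ### Uniform convergence in Archimedean vector lattices -/

section Archimedean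

variable {E : Type*} [AddCommGroup E] [Lattice E] [IsOrderedAddMonoid E] [Module ℝ E]
  [IsOrderedModule ℝ E]

theorem IsArchimedeanVL.le_of_forall_le_add_smul (hE : IsArchimedeanVL E) {x y e : E}
    (he : 0 ≤ e) (h : ∀ ε : ℝ, 0 < ε → x ≤ y + ε • e) : x ≤ y := by
  refine sub_nonpos.mp (hE (x - y) e fun n => ?_)
  rcases Nat.eq_zero_or_pos n with rfl | hn
  · rwa [zero_nsmul]
  · have hn' : (0 : ℝ) < n := Nat.cast_pos.mpr hn
    have h1 := smul_le_smul_of_nonneg_left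
      (sub_le_iff_le_add'.mpr (h (n : ℝ)⁻¹ (inv_pos.mpr hn'))) hn'.le
    rwa [smul_smul, mul_inv_cancel₀ hn'.ne', one_smul, Nat.cast_smul_eq_nsmul] at h1

theorem IsArchimedeanVL.eq_zero_of_abs_le_smul (hE : IsArchimedeanVL E) {x e : E}
    (he : 0 ≤ e) (h : ∀ ε : ℝ, 0 < ε → |x| ≤ ε • e) : x = 0 := by
  have h1 : |x| ≤ 0 := hE.le_of_forall_le_add_smul he fun ε hε => by simpa using h ε hε
  obtain ⟨h2, h3⟩ := abs_le'.mp h1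
  exact le_antisymm h2 (neg_nonpos.mp h3)

theorem UniformlyConvergesTo.abs_sub_le {x : ℕ → E} {a b s p : E} (hE : IsArchimedeanVL E)
    (hx : UniformlyConvergesTo x s) (hp : 0 ≤ p)
    (h : ∀ n : ℕ, |a - x n| ≤ b + (1 / ((n : ℝ) + 1)) • p) : |a - s| ≤ b := by
  obtain ⟨e, he, hconv⟩ := hx
  -- The regulator `p + e` absorbs the two errors, the given one and that of the convergence to `s`.
  refine hE.le_of_forall_le_add_smul (add_nonneg hp he) fun ε hε => ?_
  obtain ⟨n₀, hn₀⟩ := hconv ε hε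
  obtain ⟨m, hm⟩ := exists_nat_one_div_lt hε
  have h1 : (1 / (((max n₀ m : ℕ) : ℝ) + 1)) • p ≤ ε • p := by
    refine smul_le_smul_of_nonneg_right (le_trans ?_ hm.le) hp
    have h2 : (m : ℝ) ≤ (max n₀ m : ℕ) := Nat.cast_le.mpr (le_max_right _ _)
    gcongr
  calc |a - s| = |(a - x (max n₀ m)) + (x (max n₀ m) - s)| := by rw [sub_add_sub_cancel]
    _ ≤ |a - x (max n₀ m)| + |x (max n₀ m) - s| := abs_add_le _ _
    _ ≤ (b + ε • p) + ε • e := by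
      refine add_le_add ((h _).trans ?_) (hn₀ _ (le_max_left _ _))
      gcongr
    _ = b + ε • (p + e) := by rw [smul_add, add_assoc]

theorem VectorSublattice.exists_uniformlyConvergesTo {S : VectorSublattice E}
    (hS : IsUniformlyComplete S) {x : ℕ → E} {e : E} (hx : ∀ n, x n ∈ S) (he : e ∈ S)
    (he0 : 0 ≤ e)
    (h : ∀ m n : ℕ, |x m - x n| ≤ (1 / ((m : ℝ) + 1) + 1 / ((n : ℝ) + 1)) • e) :
    ∃ s ∈ S, UniformlyConvergesTo x s := by
  obtain ⟨s, e', he', hs⟩ := hS ℕ (fun n => ⟨x n, hx n⟩) ⟨⟨e, he⟩, he0, fun ε hε => by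
    obtain ⟨k, hk⟩ := exists_nat_one_div_lt (half_pos hε)
    refine ⟨(k, k), fun ⟨m, n⟩ ⟨hm, hn⟩ => ?_⟩
    change |x m - x n - 0| ≤ ε • e
    rw [sub_zero]
    refine (h m n).trans (smul_le_smul_of_nonneg_right ?_ he0)
    have h1 : 1 / ((m : ℝ) + 1) ≤ 1 / ((k : ℝ) + 1) := by
      have : (k : ℝ) ≤ m := Nat.cast_le.mpr hm
      gcongr
    have h2 : 1 / ((n : ℝ) + 1) ≤ 1 / ((k : ℝ) + 1) := by
      have : (k : ℝ) ≤ n := Nat.cast_le.mpr hn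
      gcongr
    linarith⟩
  exact ⟨s, s.2, e', he', hs⟩

/-- The Riesz decomposition of an element whose absolute value lies below a sum. -/
theorem exists_add_eq_of_abs_le_add {E : Type*} [AddCommGroup E] [Lattice E]
    [IsOrderedAddMonoid E] {w a b : E} (ha : 0 ≤ a) (hb : 0 ≤ b)
    (h : |w| ≤ a + b) : ∃ w₁ w₂, w₁ + w₂ = w ∧ |w₁| ≤ a ∧ |w₂| ≤ b := by
  obtain ⟨h1, h2⟩ := abs_le'.mp h
  -- The first part is `w` truncated to `[-a, a]`.
  refine ⟨(w ⊓ a) ⊔ (-a), w - ((w ⊓ a) ⊔ (-a)), by abel, abs_le'.mpr ⟨?_, ?_⟩,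
    abs_le'.mpr ⟨?_, ?_⟩⟩
  · exact sup_le inf_le_right (neg_le_self ha)
  · exact neg_le.mp le_sup_right
  · rw [sub_le_comm]
    exact le_sup_of_le_left (le_inf (sub_le_self _ hb) (sub_le_iff_le_add.mpr h1))
  · rw [neg_sub, sub_le_iff_le_add]
    refine sup_le (inf_le_left.trans (le_add_of_nonneg_left hb)) ?_
    have : -w ≤ b + a := h2.trans (add_comm a b).le
    rw [← sub_nonneg] at this ⊢
    convert this using 1
    abel

/-- Bounds for `T` on `[-e, e]` scale with `c`; the point is that `u` does not depend on `c`. -/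
theorem IsOrderBoundedOp.exists_abs_le {F : Type*} [AddCommGroup F] [Lattice F]
    [IsOrderedAddMonoid F] [Module ℝ F] [IsOrderedModule ℝ F] {T : E →ₗ[ℝ] F}
    (hT : IsOrderBoundedOp T) (e : E) :
    ∃ u : F, 0 ≤ u ∧ ∀ (c : ℝ) (w : E), 0 < c → |w| ≤ c • e → |T w| ≤ c • u := by
  obtain ⟨p, q, hpq⟩ := hT (-e) e
  refine ⟨|p| + |q|, add_nonneg (abs_nonneg _) (abs_nonneg _), fun c w hc hw => ?_⟩
  obtain ⟨h1, h2⟩ := abs_le'.mp hw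
  have hinv : ∀ {x : E}, x ≤ c • e → c⁻¹ • x ≤ e := fun {x} hx => by
    simpa [smul_smul, hc.ne'] using smul_le_smul_of_nonneg_left hx (inv_nonneg.mpr hc.le)
  obtain ⟨h3, h4⟩ := hpq (c⁻¹ • w) (neg_le.mp (by simpa using hinv h2)) (hinv h1)
  have h5 : |T (c⁻¹ • w)| ≤ |p| + |q| := abs_le'.mpr
    ⟨h4.trans ((le_abs_self q).trans (le_add_of_nonneg_left (abs_nonneg p))),
      (neg_le_neg h3).trans ((neg_le_abs p).trans (le_add_of_nonneg_right (abs_nonneg q)))⟩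
  have hmul : ∀ {y : F}, c⁻¹ • y ≤ |p| + |q| → y ≤ c • (|p| + |q|) := fun {y} hy => by
    simpa [smul_smul, hc.ne'] using smul_le_smul_of_nonneg_left hy hc.le
  obtain ⟨h6, h7⟩ := abs_le'.mp h5
  rw [map_smul] at h6 h7
  exact abs_le'.mpr ⟨hmul h6, hmul (by simpa using h7)⟩

end Archimedean

namespace IsOrderCompletion

variable {E Z : Type*} [AddCommGroup E] [Lattice E] [Module ℝ E]
  [AddCommGroup Z] [Lattice Z] [Module ℝ Z] {j : E →ₗ[ℝ] Z}

theorem le_iff (hj : IsOrderCompletion j) {a b : E} : j a ≤ j b ↔ a ≤ b := by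
  rw [← sup_eq_right, ← hj.map_sup, hj.injective.eq_iff, sup_eq_right]

theorem map_abs (hj : IsOrderCompletion j) (a : E) : j |a| = |j a| := by
  rw [abs, hj.map_sup, map_neg, abs]

/-- If `s` is the supremum of the multiples of `x`, then `s - x` is also an upper bound, so `x ≤ 0`.
-/
theorem isArchimedeanVL [IsOrderedAddMonoid Z] (hj : IsOrderCompletion j) :
    IsArchimedeanVL Z := by
  intro x y h
  obtain ⟨s, hs, hs'⟩ := hj.order_complete (range fun n : ℕ => n • x) (range_nonempty _)
    ⟨y, by rintro _ ⟨n, rfl⟩; exact h n⟩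
  have h1 : s ≤ s - x := hs' (by
    rintro _ ⟨n, rfl⟩
    have := hs (mem_range_self (n + 1))
    simp only [succ_nsmul] at this
    exact le_sub_iff_add_le.mpr this)
  have := sub_nonneg.mpr h1
  rwa [sub_sub_cancel_left, neg_nonneg] at this

end IsOrderCompletion

theorem VectorSublattice.isArchimedeanVL {K : Type*} [TopologicalSpace K]
    (S : VectorSublattice C(K, ℝ)) : IsArchimedeanVL S := by
  intro x y h t
  by_contra hx
  have hx' : 0 < (x : C(K, ℝ)) t := not_le.mp hx
  obtain ⟨n, hn⟩ := exists_nat_gt ((y : C(K, ℝ)) t / (x : C(K, ℝ)) t)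
  have h1 : (n • (x : C(K, ℝ))) t ≤ (y : C(K, ℝ)) t := h n t
  rw [ContinuousMap.smul_apply, nsmul_eq_mul] at h1
  exact absurd ((div_lt_iff₀ hx').mp hn) (not_lt.mpr h1)

namespace BallHager

/-! ### The order completions -/

theorem const_mem_lattice (c : ℝ) : ContinuousMap.const P c ∈ lattice :=
  Submodule.mem_sup_left ⟨ContinuousMap.const _ c, rfl⟩

theorem pole_mem_lattice (q : Icc (0 : ℚ) 1) : pole q ∈ lattice :=
  Submodule.mem_sup_right (Submodule.subset_span ⟨q, rfl⟩)

/-- The `n`-th partial sum of the function `g`. -/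
noncomputable def partialOscillation (r : ℕ → Icc (0 : ℚ) 1) (N : ℕ) (t : P) : ℝ :=
  ∑ n ∈ Finset.range N, 1 / 2 ^ (n + 1) * Real.sin (pole (r n) t)

/-- The tail is at most `2⁻ᴺ`; the weaker rate `1/(N + 1)` is the one used for all sequences below.
-/
theorem abs_oscillation_sub_le (r : ℕ → Icc (0 : ℚ) 1) (N : ℕ) (t : P) :
    |oscillation r t - partialOscillation r N t| ≤ 1 / ((N : ℝ) + 1) := by
  have hs := summable_half_pow_mul_sin fun k => pole (r k) t
  rw [oscillation_apply, ← hs.sum_add_tsum_nat_add N, partialOscillation, add_sub_cancel_left]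
  have hg := hasSum_geometric_two' ((1 : ℝ) / 2 ^ N)
  refine (tsum_of_norm_bounded hg fun n => (norm_half_pow_mul_sin_le _ _).trans_eq ?_).trans ?_
  · rw [pow_succ, pow_add]
    field_simp
  · refine one_div_le_one_div_of_le (by positivity) ?_
    exact_mod_cast Nat.lt_two_pow_self

theorem exists_majorant {r : ℕ → Icc (0 : ℚ) 1} {f : C(P, ℝ)} (hf : f ∈ extension r) :
    ∃ x ∈ lattice, ∀ t, |f t| ≤ x t := by
  let S : VectorSublattice C(P, ℝ) := VectorSublattice.ofAbsMem
    { carrier := {f | ∃ x ∈ lattice, ∀ t, |f t| ≤ x t}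
      add_mem' := by
        rintro f g ⟨x, hx, hfx⟩ ⟨y, hy, hgy⟩
        exact ⟨x + y, add_mem hx hy, fun t => (abs_add_le _ _).trans (add_le_add (hfx t) (hgy t))⟩
      zero_mem' := ⟨0, zero_mem lattice, fun t => by simp⟩
      smul_mem' := by
        rintro c f ⟨x, hx, hfx⟩
        refine ⟨|c| • x, SMulMemClass.smul_mem |c| hx, fun t => ?_⟩
        simp only [ContinuousMap.smul_apply, smul_eq_mul, abs_mul]
        exact mul_le_mul_of_nonneg_left (hfx t) (abs_nonneg c) }
    (by
      rintro f ⟨x, hx, hfx⟩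
      exact ⟨x, hx, fun t => by simpa using hfx t⟩)
  refine extension_le (S := S) (fun x hx => ⟨|x|, abs_mem_space hx, fun t => le_rfl⟩)
    ⟨_, const_mem_lattice 1, fun t => ?_⟩ hf
  -- The empty partial sum is zero, so the case `N = 0` says `|g| ≤ 1`.
  simpa [partialOscillation] using abs_oscillation_sub_le r 0 t

/-- A tent function of height `f t₀ / 2`, supported where `f > f t₀ / 2`, lies below `f`. -/
theorem exists_pos_le {f : C(P, ℝ)} (hf : 0 < f) : ∃ x ∈ lattice, 0 < x ∧ x ≤ f := by
  obtain ⟨hf0, t₀, ht₀⟩ : (∀ t, 0 ≤ f t) ∧ ∃ t, 0 < f t := by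
    refine ⟨fun t => hf.le t, ?_⟩
    by_contra! h
    exact hf.not_ge h
  obtain ⟨V, hV, hVf⟩ := isOpen_induced_iff.mp (isOpen_lt (continuous_const (y := f t₀ / 2))
    f.continuous)
  have ht₀V : (t₀ : Icc (0 : ℝ) 1) ∈ V := by
    have : t₀ ∈ {t | f t₀ / 2 < f t} := half_lt_self ht₀
    rwa [← hVf] at this
  obtain ⟨ε, hε, hball⟩ := Metric.isOpen_iff.mp hV _ ht₀V
  let v : C(Icc (0 : ℝ) 1, ℝ) := ⟨fun x => f t₀ / 2 * max 0 (1 - dist x t₀ / ε), by fun_prop⟩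
  have hv0 : 0 ≤ restrict v := fun t =>
    mul_nonneg (half_pos ht₀).le (le_max_left _ _)
  have hvt : restrict v t₀ = f t₀ / 2 := by simp [v, restrict]
  refine ⟨restrict v, Submodule.mem_sup_left ⟨v, rfl⟩, lt_of_le_not_ge hv0 fun h => ?_,
    fun t => ?_⟩
  · have h1 : restrict v t₀ ≤ 0 := h t₀
    rw [hvt] at h1
    linarith
  · change f t₀ / 2 * max 0 (1 - dist (t : Icc (0 : ℝ) 1) t₀ / ε) ≤ f t
    by_cases ht : dist (t : Icc (0 : ℝ) 1) t₀ < ε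
    · have h1 : t ∈ {t | f t₀ / 2 < f t} := by
        rw [← hVf]
        exact hball ht
      refine le_trans (mul_le_of_le_one_right (half_pos ht₀).le (max_le zero_le_one ?_))
        (le_of_lt h1)
      exact sub_le_self _ (by positivity)
    · have h1 : 1 ≤ dist (t : Icc (0 : ℝ) 1) t₀ / ε := (one_le_div hε).mpr (not_lt.mp ht)
      rw [max_eq_left (by linarith), mul_zero]
      exact hf0 t

theorem isOrderCompletion_comp_inclusion {r : ℕ → Icc (0 : ℚ) 1} {Z : Type*} [AddCommGroup Z]
    [Lattice Z] [Module ℝ Z] {j : extension r →ₗ[ℝ] Z} (hj : IsOrderCompletion j) :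
    IsOrderCompletion (j ∘ₗ VectorSublattice.inclusion (lattice_le_extension r)) where
  injective := hj.injective.comp fun _ _ h => 
    Subtype.ext (congrArg (fun y : extension r => (y : C(P, ℝ))) h)
  map_sup a b := hj.map_sup (VectorSublattice.inclusion (lattice_le_extension r) a)
    (VectorSublattice.inclusion (lattice_le_extension r) b)
  order_complete := hj.order_complete
  order_dense z hz := by
    obtain ⟨y, hy, hyz⟩ := hj.order_dense z hz
    have hy0 : 0 < y := by
      rw [← map_zero j] at hy
      exact lt_of_le_not_ge (hj.le_iff.mp hy.le) fun h => hy.not_ge (hj.le_iff.mpr h)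
    obtain ⟨x, hx, hx0, hxy⟩ := exists_pos_le (f := y) hy0
    refine ⟨⟨x, hx⟩, lt_of_le_of_ne ?_ fun h => ?_, le_trans ?_ hyz⟩
    · rw [← map_zero (j ∘ₗ VectorSublattice.inclusion (lattice_le_extension r))]
      exact hj.le_iff.mpr hx0.le
    · rw [← map_zero j] at h
      exact hx0.ne (congrArg Subtype.val (hj.injective h))
    · exact hj.le_iff.mpr hxy
  majorizing z := by
    obtain ⟨y, hy⟩ := hj.majorizing z
    obtain ⟨x, hx, hyx⟩ := exists_majorant y.2
    exact ⟨⟨x, hx⟩, hy.trans (hj.le_iff.mpr fun t => (le_abs_self _).trans (hyx t))⟩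

/-! ### Approximation of `g` by elements of `X` -/

/-- The function `sin (1 / |t - q|)`, cut off near `q`. -/
noncomputable def truncatedSin (q : Icc (0 : ℚ) 1) (M : ℕ) : C(Icc (0 : ℝ) 1, ℝ) where
  toFun x := Real.sin (1 / max |(x : ℝ) - ((q : ℚ) : ℝ)| (1 / ((M : ℝ) + 1)))
  continuous_toFun := Real.continuous_sin.comp <| continuous_const.div (by fun_prop) fun _ =>
    (lt_max_of_lt_right (by positivity)).ne'

/-- The cut-off changes the sine only where the pole exceeds `M + 1`. There the error, at most `2`,
is below `2 / (M + 1)` times the pole. -/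
theorem abs_truncatedSin_sub_le (q : Icc (0 : ℚ) 1) (M : ℕ) (t : P) :
    |restrict (truncatedSin q M) t - Real.sin (pole q t)| ≤ 2 / ((M : ℝ) + 1) * pole q t := by
  have hM : (0 : ℝ) < (M : ℝ) + 1 := by positivity
  have hp := pole_pos q t
  change |Real.sin (1 / max |t.toReal - ((q : ℚ) : ℝ)| (1 / ((M : ℝ) + 1))) - _| ≤ _
  rcases le_or_gt (1 / ((M : ℝ) + 1)) |t.toReal - ((q : ℚ) : ℝ)| with h | h
  · rw [max_eq_left h, pole_apply, sub_self, abs_zero]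
    positivity
  · have h1 : (M : ℝ) + 1 < pole q t := by
      rw [pole_apply]
      exact (lt_one_div (lt_of_le_of_ne (abs_nonneg _) (abs_sub_ne_zero q t).symm) hM).mp h
    have h2 : 1 ≤ pole q t / ((M : ℝ) + 1) := (one_le_div hM).mpr h1.le
    refine (abs_sub _ _).trans ?_
    have h3 := Real.abs_sin_le_one (1 / max |t.toReal - ((q : ℚ) : ℝ)| (1 / ((M : ℝ) + 1)))
    have h4 := Real.abs_sin_le_one (pole q t)
    have h5 : 2 / ((M : ℝ) + 1) * pole q t = 2 * (pole q t / ((M : ℝ) + 1)) := by ring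
    rw [h5]
    linarith

/-- The regulator `p`, a sum of the first `N` poles, depends on `N` but not on `M`. The functions `x
M` are the `N`-th partial sum of `g` with truncated sines. -/
theorem exists_approximation (r : ℕ → Icc (0 : ℚ) 1) (N : ℕ) :
    ∃ p ∈ lattice, (∀ t, 0 ≤ p t) ∧ ∃ x : ℕ → C(P, ℝ), (∀ M, x M ∈ lattice) ∧
      (∀ L M t, |x L t - x M t| ≤ (1 / ((L : ℝ) + 1) + 1 / ((M : ℝ) + 1)) * p t) ∧
      ∀ M t, |oscillation r t - x M t| ≤ 1 / ((N : ℝ) + 1) + 1 / ((M : ℝ) + 1) * p t := by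
  have hx : ∀ M t, |(∑ n ∈ Finset.range N, (1 / 2 ^ (n + 1) : ℝ) •
      restrict (truncatedSin (r n) M)) t - partialOscillation r N t| ≤
      1 / ((M : ℝ) + 1) * (∑ n ∈ Finset.range N, (2 / 2 ^ (n + 1) : ℝ) • pole (r n)) t := by
    intro M t
    rw [ContinuousMap.sum_apply, ContinuousMap.sum_apply, partialOscillation,
      ← Finset.sum_sub_distrib, Finset.mul_sum]
    refine (Finset.abs_sum_le_sum_abs _ _).trans (Finset.sum_le_sum fun n _ => ?_)
    simp only [ContinuousMap.smul_apply, smul_eq_mul]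
    rw [← mul_sub, abs_mul, abs_of_pos (by positivity)]
    calc _ ≤ 1 / 2 ^ (n + 1) * (2 / ((M : ℝ) + 1) * pole (r n) t) := by
          gcongr
          exact abs_truncatedSin_sub_le _ _ _
      _ = _ := by ring
  refine ⟨∑ n ∈ Finset.range N, (2 / 2 ^ (n + 1) : ℝ) • pole (r n),
    sum_mem fun n _ => SMulMemClass.smul_mem _ (pole_mem_lattice _), fun t => ?_,
    fun M => ∑ n ∈ Finset.range N, (1 / 2 ^ (n + 1) : ℝ) • restrict (truncatedSin (r n) M),
    fun M => sum_mem fun n _ => SMulMemClass.smul_mem _ (Submodule.mem_sup_left ⟨_, rfl⟩),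
    fun L M t => ?_, fun M t => ?_⟩
  · rw [ContinuousMap.sum_apply]
    exact Finset.sum_nonneg fun n _ => mul_nonneg (by positivity) (pole_pos _ _).le
  · rw [add_mul]
    refine (abs_sub_le _ (partialOscillation r N t) _).trans (add_le_add (hx L t) ?_)
    rw [abs_sub_comm]
    exact hx M t
  · refine (abs_sub_le _ (partialOscillation r N t) _).trans
      (add_le_add (abs_oscillation_sub_le r N t) ?_)
    rw [abs_sub_comm]
    exact hx M t

theorem abs_map_sub_le {r : ℕ → Icc (0 : ℚ) 1} {Z : Type*} [AddCommGroup Z] [Lattice Z]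
    [Module ℝ Z] {j : extension r →ₗ[ℝ] Z} (hj : IsOrderCompletion j)
    {a b c : extension r} (h : ∀ t, |(a : C(P, ℝ)) t - (b : C(P, ℝ)) t| ≤ (c : C(P, ℝ)) t) :
    |j a - j b| ≤ j c := by
  rw [← map_sub, ← hj.map_abs]
  exact hj.le_iff.mpr h

/-! ### Equality of the uniform completions -/

section UniformCompletion

variable {r : ℕ ≃ Icc (0 : ℚ) 1} {Z : Type*} [AddCommGroup Z] [Lattice Z] [IsOrderedAddMonoid Z]
  [Module ℝ Z] [IsOrderedModule ℝ Z] {j : extension r →ₗ[ℝ] Z}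

/-- Completeness of `S` is used twice: for fixed `N` the approximants converge to some `s N` in `S`,
which stands in for the partial sum of `g`; then the `s N` converge to the image of `g`, with the
image of `1` as regulator. -/
theorem map_oscillation_mem (hj : IsOrderCompletion j) {S : VectorSublattice Z}
    (hS : IsUniformlyComplete S) (hX : ∀ y : extension r, (y : C(P, ℝ)) ∈ lattice → j y ∈ S) :
    j ⟨oscillation r, oscillation_mem_extension r⟩ ∈ S := by
  have hZ := hj.isArchimedeanVL
  let ι : ∀ x : C(P, ℝ), x ∈ lattice → extension r := fun x hx => ⟨x, lattice_le_extension r hx⟩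
  let e : Z := j (ι _ (const_mem_lattice 1))
  have he0 : 0 ≤ e := by
    rw [← map_zero j]
    exact hj.le_iff.mpr fun t => zero_le_one
  have step : ∀ N : ℕ, ∃ s ∈ S,
      |j ⟨oscillation r, oscillation_mem_extension r⟩ - s| ≤ (1 / ((N : ℝ) + 1)) • e := by
    intro N
    obtain ⟨p, hp, hp0, x, hx, hxx, hgx⟩ := exists_approximation r N
    have hp0' : 0 ≤ j (ι p hp) := by
      rw [← map_zero j]
      exact hj.le_iff.mpr hp0
    obtain ⟨s, hs, hxs⟩ := VectorSublattice.exists_uniformlyConvergesTo hS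
      (x := fun M => j (ι (x M) (hx M))) (fun M => hX _ (hx M)) (hX (ι p hp) hp) hp0'
      fun L M => by
        rw [← map_smul]
        exact abs_map_sub_le hj (hxx L M)
    refine ⟨s, hs, hxs.abs_sub_le hZ hp0' fun M => ?_⟩
    rw [← map_smul, ← map_smul, ← map_add]
    refine abs_map_sub_le hj fun t => (hgx M t).trans_eq ?_
    change _ = 1 / ((N : ℝ) + 1) * 1 + _
    rw [mul_one]
    rfl
  choose s hs hgs using step
  obtain ⟨a, ha, hsa⟩ := VectorSublattice.exists_uniformlyConvergesTo hS hs
    (hX (ι _ (const_mem_lattice 1)) (const_mem_lattice 1)) he0 fun m n => by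
      rw [add_smul, ← sub_add_sub_cancel _ (j ⟨_, oscillation_mem_extension r⟩)]
      refine (abs_add_le _ _).trans (add_le_add ?_ (hgs n))
      rw [abs_sub_comm]
      exact hgs m
  have h0 := hsa.abs_sub_le (b := 0) hZ he0 fun n => by simpa using hgs n
  have h1 := hZ.eq_zero_of_abs_le_smul le_rfl fun ε _ => by simpa using h0
  rwa [sub_eq_zero.mp h1]

theorem range_subset_of_uniformlyComplete (hj : IsOrderCompletion j) {S : VectorSublattice Z}
    (hS : IsUniformlyComplete S) (hX : ∀ y : extension r, (y : C(P, ℝ)) ∈ lattice → j y ∈ S) :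
    range j ⊆ S := by
  let R : VectorSublattice C(P, ℝ) :=
    { carrier := {f | ∃ hf : f ∈ extension r, j ⟨f, hf⟩ ∈ S}
      add_mem' := by
        rintro f g ⟨hf, hfS⟩ ⟨hg, hgS⟩
        refine ⟨add_mem hf hg, ?_⟩
        have := add_mem hfS hgS
        rwa [← map_add] at this
      zero_mem' := ⟨zero_mem _, by
        have := zero_mem S
        rwa [← map_zero j] at this⟩
      smul_mem' := by
        rintro c f ⟨hf, hfS⟩
        refine ⟨SMulMemClass.smul_mem c hf, ?_⟩
        have := SMulMemClass.smul_mem c hfS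
        rwa [← map_smul] at this
      sup_mem' := by
        rintro f g ⟨hf, hfS⟩ ⟨hg, hgS⟩
        refine ⟨VectorSublattice.sup_mem _ hf hg, ?_⟩
        have := VectorSublattice.sup_mem _ hfS hgS
        rwa [← hj.map_sup] at this }
  have hR : extension r ≤ R := extension_le (fun x hx => ⟨lattice_le_extension r hx, hX _ hx⟩)
    ⟨oscillation_mem_extension r, map_oscillation_mem hj hS hX⟩
  rintro _ ⟨y, rfl⟩
  obtain ⟨_, h⟩ := hR y.2
  exact h

theorem uniformCompletionIn_eq (hj : IsOrderCompletion j) :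
    uniformCompletionIn j =
      uniformCompletionIn (j ∘ₗ VectorSublattice.inclusion (lattice_le_extension r)) := by
  refine Subset.antisymm (fun z hz S hS hX => hz S hS ?_) fun z hz S hS hY => hz S hS ?_
  · exact range_subset_of_uniformlyComplete hj hS fun y hy => hX ⟨⟨y, hy⟩, rfl⟩
  · rintro _ ⟨x, rfl⟩
    exact hY (mem_range_self _)

end UniformCompletion

/-! ### Order bounded operators -/

/-- The functions `f` for which there are `u` in `X` and, for all `ε`, an `e` in `X` such that for
all `δ` some element of `X` has a distance at most `ε u + δ e` from `f`. -/
noncomputable def approximable : VectorSublattice C(P, ℝ) :=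
  VectorSublattice.ofAbsMem
    { carrier := {f | ∃ u ∈ lattice, (∀ t, 0 ≤ u t) ∧ ∀ ε : ℝ, 0 < ε →
        ∃ e ∈ lattice, (∀ t, 0 ≤ e t) ∧ ∀ δ : ℝ, 0 < δ →
          ∃ x ∈ lattice, ∀ t, |f t - x t| ≤ ε * u t + δ * e t}
      add_mem' := by
        rintro f g ⟨u, hu, hu0, hf⟩ ⟨v, hv, hv0, hg⟩
        refine ⟨u + v, add_mem hu hv, fun t => add_nonneg (hu0 t) (hv0 t), fun ε hε => ?_⟩
        obtain ⟨d, hd, hd0, hf⟩ := hf ε hε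
        obtain ⟨e, he, he0, hg⟩ := hg ε hε
        refine ⟨d + e, add_mem hd he, fun t => add_nonneg (hd0 t) (he0 t), fun δ hδ => ?_⟩
        obtain ⟨x, hx, hf⟩ := hf δ hδ
        obtain ⟨y, hy, hg⟩ := hg δ hδ
        refine ⟨x + y, add_mem hx hy, fun t => ?_⟩
        simp only [ContinuousMap.add_apply]
        calc _ = |(f t - x t) + (g t - y t)| := by ring_nf
          _ ≤ (ε * u t + δ * d t) + (ε * v t + δ * e t) :=
            (abs_add_le _ _).trans (add_le_add (hf t) (hg t))
          _ = _ := by ring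
      zero_mem' := ⟨0, zero_mem lattice, fun t => le_rfl, fun ε _ => ⟨0, zero_mem lattice,
        fun t => le_rfl, fun δ _ => ⟨0, zero_mem lattice, fun t => by simp⟩⟩⟩
      smul_mem' := by
        rintro c f ⟨u, hu, hu0, hf⟩
        refine ⟨|c| • u, SMulMemClass.smul_mem |c| hu,
          fun t => mul_nonneg (abs_nonneg c) (hu0 t), fun ε hε => ?_⟩
        obtain ⟨d, hd, hd0, hf⟩ := hf ε hε
        refine ⟨|c| • d, SMulMemClass.smul_mem |c| hd,
          fun t => mul_nonneg (abs_nonneg c) (hd0 t), fun δ hδ => ?_⟩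
        obtain ⟨x, hx, hf⟩ := hf δ hδ
        refine ⟨c • x, SMulMemClass.smul_mem c hx, fun t => ?_⟩
        simp only [ContinuousMap.smul_apply, smul_eq_mul]
        calc _ = |c| * |f t - x t| := by rw [← mul_sub, abs_mul]
          _ ≤ |c| * (ε * u t + δ * d t) := mul_le_mul_of_nonneg_left (hf t) (abs_nonneg c)
          _ = _ := by ring }
    (by
      rintro f ⟨u, hu, hu0, hf⟩
      refine ⟨u, hu, hu0, fun ε hε => ?_⟩
      obtain ⟨d, hd, hd0, hf⟩ := hf ε hε
      refine ⟨d, hd, hd0, fun δ hδ => ?_⟩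
      obtain ⟨x, hx, hf⟩ := hf δ hδ
      exact ⟨|x|, abs_mem_space hx, fun t => (abs_abs_sub_abs_le _ _).trans (hf t)⟩)

theorem extension_le_approximable (r : ℕ → Icc (0 : ℚ) 1) : extension r ≤ approximable := by
  refine extension_le (fun x hx => ⟨0, zero_mem lattice, fun t => le_rfl, fun ε _ =>
    ⟨0, zero_mem lattice, fun t => le_rfl, fun δ _ => ⟨x, hx, fun t => by simp⟩⟩⟩)
    ⟨_, const_mem_lattice 1, fun t => zero_le_one, fun ε hε => ?_⟩
  obtain ⟨N, hN⟩ := exists_nat_one_div_lt hε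
  obtain ⟨p, hp, hp0, x, hx, -, hgx⟩ := exists_approximation r N
  refine ⟨p, hp, hp0, fun δ hδ => ?_⟩
  obtain ⟨M, hM⟩ := exists_nat_one_div_lt hδ
  refine ⟨x M, hx M, fun t => (hgx M t).trans (add_le_add ?_ ?_)⟩
  · simpa using hN.le
  · exact mul_le_mul_of_nonneg_right hM.le (hp0 t)

/-- `T y` equals `T (y - x)`, and Riesz decomposition splits `y - x` along `ε u + δ e`, so `|T y| ≤
ε U + δ W`. Here `W` depends on `ε` but `U` does not: `δ` tends to zero first, then `ε`, each time
by the Archimedean property of `H`. -/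
theorem eq_zero_of_isOrderBoundedOp {r : ℕ → Icc (0 : ℚ) 1} {H : Type*} [AddCommGroup H]
    [Lattice H] [IsOrderedAddMonoid H] [Module ℝ H] [IsOrderedModule ℝ H]
    (hH : IsArchimedeanVL H) {T : extension r →ₗ[ℝ] H} (hT : IsOrderBoundedOp T)
    (hX : ∀ y : extension r, (y : C(P, ℝ)) ∈ lattice → T y = 0) : T = 0 := by
  ext y
  rw [LinearMap.zero_apply]
  let ι : ∀ x : C(P, ℝ), x ∈ lattice → extension r := fun x hx => ⟨x, lattice_le_extension r hx⟩
  obtain ⟨u, hu, hu0, hy⟩ := extension_le_approximable r y.2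
  obtain ⟨U, hU0, hU⟩ := hT.exists_abs_le (ι u hu)
  refine hH.eq_zero_of_abs_le_smul hU0 fun ε hε => ?_
  obtain ⟨e, he, he0, hy⟩ := hy ε hε
  obtain ⟨W, hW0, hW⟩ := hT.exists_abs_le (ι e he)
  refine hH.le_of_forall_le_add_smul hW0 fun δ hδ => ?_
  obtain ⟨x, hx, hy⟩ := hy δ hδ
  obtain ⟨w₁, w₂, hw, hw₁, hw₂⟩ := exists_add_eq_of_abs_le_add (w := y - ι x hx)
    (a := ε • ι u hu) (b := δ • ι e he) (fun t => mul_nonneg hε.le (hu0 t))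
    (fun t => mul_nonneg hδ.le (he0 t)) hy
  have hTy : T y = T w₁ + T w₂ := by
    rw [← map_add, hw, map_sub, hX (ι x hx) hx, sub_zero]
  rw [hTy]
  exact (abs_add_le _ _).trans (add_le_add (hU ε w₁ hε hw₁) (hW δ w₂ hδ hw₂))

end BallHager

/-! ### The theorem -/

theorem mainTheorem12 (r : ℕ ≃ Icc (0 : ℚ) 1) :
    -- `X` is a uniformly closed proper subset of `Y`
    IsUniformlyClosed {y : BallHager.extension r | (y : C(BallHager.P, ℝ)) ∈ BallHager.lattice} ∧
    (∃ y : BallHager.extension r, (y : C(BallHager.P, ℝ)) ∉ BallHager.lattice) ∧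
    -- `Y` has an order completion, every order completion `Z` of `Y` is an order completion
    -- of `X`, and the uniform completions of `X` and `Y`, formed in `Z`, are equal
    (∃ (Z : Type) (_ : AddCommGroup Z) (_ : Lattice Z) (_ : IsOrderedAddMonoid Z)
      (_ : Module ℝ Z) (_ : IsOrderedModule ℝ Z) (j : BallHager.extension r →ₗ[ℝ] Z),
      IsOrderCompletion j) ∧
    (∀ (Z : Type u) [AddCommGroup Z] [Lattice Z] [IsOrderedAddMonoid Z]
      [Module ℝ Z] [IsOrderedModule ℝ Z] (j : BallHager.extension r →ₗ[ℝ] Z),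
      IsOrderCompletion j →
        IsOrderCompletion
          (j ∘ₗ VectorSublattice.inclusion (BallHager.lattice_le_extension r)) ∧
        uniformCompletionIn j = uniformCompletionIn
          (j ∘ₗ VectorSublattice.inclusion (BallHager.lattice_le_extension r))) ∧
    -- every order bounded operator on `Y` that vanishes on `X` is zero
    (∀ (H : Type v) [AddCommGroup H] [Lattice H] [IsOrderedAddMonoid H]
      [Module ℝ H] [IsOrderedModule ℝ H], IsArchimedeanVL H →
      ∀ T : BallHager.extension r →ₗ[ℝ] H, IsOrderBoundedOp T →
        (∀ y : BallHager.extension r, (y : C(BallHager.P, ℝ)) ∈ BallHager.lattice → T y = 0) →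
        T = 0) ∧
    -- `X` is not the kernel of an order bounded operator on `Y`
    (∀ (H : Type v) [AddCommGroup H] [Lattice H] [IsOrderedAddMonoid H]
      [Module ℝ H] [IsOrderedModule ℝ H], IsArchimedeanVL H →
      ∀ T : BallHager.extension r →ₗ[ℝ] H, IsOrderBoundedOp T →
        (LinearMap.ker T : Set (BallHager.extension r)) ≠
          {y : BallHager.extension r | (y : C(BallHager.P, ℝ)) ∈ BallHager.lattice}) := by
  refine ⟨BallHager.isUniformlyClosed_lattice r,
    ⟨⟨_, BallHager.oscillation_mem_extension r⟩, BallHager.oscillation_notMem_lattice r⟩, ?_,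
    fun Z _ _ _ _ _ j hj =>
      ⟨BallHager.isOrderCompletion_comp_inclusion hj, BallHager.uniformCompletionIn_eq hj⟩,
    fun H _ _ _ _ _ hH T hT hX => BallHager.eq_zero_of_isOrderBoundedOp hH hT hX,
    fun H _ _ _ _ _ hH T hT hker => ?_⟩
  · have : Fact (IsArchimedeanVL (BallHager.extension r)) :=
      ⟨VectorSublattice.isArchimedeanVL _⟩
    exact ⟨OrderCut (BallHager.extension r), inferInstance, inferInstance, inferInstance,
      inferInstance, inferInstance, OrderCut.embedding _, OrderCut.isOrderCompletion_embedding⟩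
  · have hT0 := BallHager.eq_zero_of_isOrderBoundedOp hH hT fun y hy =>
      LinearMap.mem_ker.mp (hker.ge hy)
    have hg : (⟨_, BallHager.oscillation_mem_extension r⟩ : BallHager.extension r) ∈
        (LinearMap.ker T : Set (BallHager.extension r)) := by
      rw [SetLike.mem_coe, LinearMap.mem_ker, hT0, LinearMap.zero_apply]
    rw [hker] at hg
    exact BallHager.oscillation_notMem_lattice r hg
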